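/- **Setting.** Let $r_f\in(0,1)$ and let $\ell:\mathbb R^d\times\mathbb R^s\to\mathbb R$ be such that, for every data point $\xi\in\mathbb R^s$, $\ell(\cdot,\xi)$ is differentiable, $\mu$-strongly convex and $\beta$-smooth on $\mathbb R^d$ and $L$-Lipschitz on a region $\Theta\subseteq\mathbb R^d$ (with $\mu,\beta,L>0$). For a probability distribution $\mathcal D$ on $\mathbb R^s$ put $\mathcal L(\theta,\mathcal D)=\mathbb E_{\xi\sim\mathcal D}[\ell(\theta,\xi)]$. Call a pair of distributions $(\mathcal D_r,\mathcal D_f)$ (retain, forget) admissible if these risks are finite for all $\theta$ and the trained model $\theta^*=\arg\min_\theta\mathcal L(\theta,\,r_f\mathcal D_f+(1-r_f)\mathcal D_r)$ is an interior point of $\Theta$. Let $\theta_r^*=\arg\min_\theta\mathcal L(\theta,\mathcal D_r)$, $\kappa_\ell=\beta/\mu$, $e_0=L^2/\mu$, $\kappa_{\varepsilon,\delta}=\varepsilon^{-1}\sqrt{2\log(2.5/\delta)}$ and $$\nu_T=\sqrt{2h(T,\delta)}\;L\,\frac{1+\kappa_\ell}{\mu\sqrt T},\qquad h(T,\delta)=1+624\bigl(\log\log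 T+\log(2/\delta)\bigr)\qquad(T\ge 2).$$ **Algorithm VRU** with horizon $T\ge 2$: start at $\theta_0=\theta^*$; for $t=1,\dots,T$ draw fresh independent $\xi^r_t\sim\mathcal D_r$, $\xi^f_t\sim\mathcal D_f$ and set $$\theta_{t}=\mathrm{proj}_{B\left(\theta^*,\frac{r_f}{1-r_f}\frac L\mu\right)}\Bigl(\theta_{t-1}-\tfrac1{\mu t}\bigl[\nabla\ell(\theta_{t-1},\xi^r_t)-\nabla\ell(\theta^*,\xi^r_t)-\tfrac{r_f}{1-r_f}\nabla\ell(\theta^*,\xi^f_t)\bigr]\Bigr);$$ output $\tilde\theta_T=\theta_T+\frac{r_f}{1-r_f}\,\nu_T\,\kappa_{\varepsilon,\delta}\,Z$ with $Z\sim\mathcal N(0,I_d)$ independent. **Theorem 1.** (i) Let $0<\varepsilon\le1$, $0<\delta<1$ and $T\ge2$. VRU satisfies $(\varepsilon,\delta)$-unlearning: there is a randomized retraining map $\mathcal A$, whose output law depends on the retain distribution but not on the forget distribution, such that for all admissible $(\mathcal D_r,\mathcal D_f)$ and all measurable $S\subseteq\mathbb R^d$, $$\mathbb P[\tilde\theta_T\in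 S]\le e^{\varepsilon}\,\mathbb P[\mathcal A(\mathcal D_r)\in S]+\delta,\qquad \mathbb P[\mathcal A(\mathcal D_r)\in S]\le e^{\varepsilon}\,\mathbb P[\tilde\theta_T\in S]+\delta .$$ (ii) For an error threshold $e>0$ let $T_e(\ell,\mathrm{VRU})$ be the least $T\ge2$ with $\mathbb E[\mathcal L(\tilde\theta_T,\mathcal D_r)-\mathcal L(\theta_r^*,\mathcal D_r)]\le e$. Then $$T_e(\ell,\mathrm{VRU})=\tilde{\mathcal O}(X),\qquad X=\kappa_\ell^3\Bigl(1+d\,\kappa_{\varepsilon,\delta}^2\log\tfrac1\delta\Bigr)\frac{e_0}{e}\Bigl(\frac{r_f}{1-r_f}\Bigr)^2 .$$ Precisely: for every $\delta_0\in(0,1)$ there is a constant $C>0$, depending only on $\delta_0$, such that for all $d,s,\ell,\Theta,\mu,\beta,L$ and $r_f$ as above, all admissible $(\mathcal D_r,\mathcal D_f)$, and all $\varepsilon>0$, $0<\delta\le\delta_0$ and $e>0$, the time $T_e(\ell,\mathrm{VRU})$ is finite and $$T_e(\ell,\mathrm{VRU})\le\max\bigl\{2,\;C\,X\,\log\log(16+X)\bigr\}.$$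 -/

import Mathlib

open MeasureTheory ProbabilityTheory
open scoped Gradient RealInnerProductSpace

namespace VRU

/-- Euclidean space `ℝⁿ`, used both for the parameters and for the data points. -/
abbrev E (n : ℕ) : Type := EuclideanSpace ℝ (Fin n)

/-- Sample losses `ℓ θ ξ` of a parameter `θ ∈ ℝᵈ` and a data point `ξ ∈ ℝˢ`: differentiable in `θ`,
`μ`-strongly convex and `β`-smooth on `ℝᵈ`, and `L`-Lipschitz on the region `Θ`.
(For `d ≥ 1` no strongly convex function is Lipschitz on the whole of `ℝᵈ`.) -/
structure IsRegularLoss {d s : ℕ} (ℓ : E d → E s → ℝ) (Θ : Set (E d)) (μ β L : ℝ) : Prop where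
  mu_pos : 0 < μ
  beta_pos : 0 < β
  lip_pos : 0 < L
  measurable : ∀ θ, Measurable (ℓ θ)
  differentiable : ∀ ξ, Differentiable ℝ (fun θ => ℓ θ ξ)
  strongly_convex : ∀ ξ θ θ',
    ℓ θ ξ + ⟪∇ (fun x => ℓ x ξ) θ, θ' - θ⟫ + μ / 2 * ‖θ' - θ‖ ^ 2 ≤ ℓ θ' ξ
  smooth : ∀ ξ θ θ', ‖∇ (fun x => ℓ x ξ) θ - ∇ (fun x => ℓ x ξ) θ'‖ ≤ β * ‖θ - θ'‖
  lipschitz : ∀ ξ, ∀ θ ∈ Θ, ∀ θ' ∈ Θ, |ℓ θ ξ - ℓ θ' ξ| ≤ L * ‖θ - θ'‖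

section Definitions

variable {d s : ℕ}

/-- The population risk `𝓛(θ, 𝒟) = 𝔼_{ξ ∼ 𝒟} ℓ(θ, ξ)`. -/
noncomputable def risk (ℓ : E d → E s → ℝ) (D : Measure (E s)) (θ : E d) : ℝ :=
  ∫ ξ, ℓ θ ξ ∂D

/-- The training distribution `r_f 𝒟_f + (1 - r_f) 𝒟_r`. -/
noncomputable def mixture (rf : ℝ) (Dr Df : Measure (E s)) : Measure (E s) :=
  ENNReal.ofReal rf • Df + ENNReal.ofReal (1 - rf) • Dr

/-- A global minimizer of `f` (an arbitrary point if there is none). -/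
noncomputable def argMin (f : E d → ℝ) : E d :=
  Classical.epsilon fun θ => IsMinOn f Set.univ θ

/-- The trained model `θ*`, the minimizer of the risk on the training distribution. -/
noncomputable def trained (ℓ : E d → E s → ℝ) (rf : ℝ) (Dr Df : Measure (E s)) : E d :=
  argMin (risk ℓ (mixture rf Dr Df))

/-- The pairs of (probability) distributions for which the risks are finite and the trained model
is an interior point of the region on which the loss is Lipschitz. -/
structure Admissible (ℓ : E d → E s → ℝ) (Θ : Set (E d)) (rf : ℝ)
    (Dr Df : Measure (E s)) : Prop where
  prob_retain : IsProbabilityMeasure Dr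
  prob_forget : IsProbabilityMeasure Df
  integrable_retain : ∀ θ, Integrable (ℓ θ) Dr
  integrable_forget : ∀ θ, Integrable (ℓ θ) Df
  trained_mem : trained ℓ rf Dr Df ∈ interior Θ

/-- Euclidean projection onto the closed ball of radius `R` around `c`. -/
noncomputable def ballProj (c : E d) (R : ℝ) (x : E d) : E d :=
  if ‖x - c‖ ≤ R then x else c + (R / ‖x - c‖) • (x - c)

/-- `ballProj c R x` is the point of the ball that is nearest to `x`. -/
theorem ballProj_spec (c : E d) {R : ℝ} (hR : 0 ≤ R) (x : E d) :
    ballProj c R x ∈ Metric.closedBall c R ∧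
      ∀ y ∈ Metric.closedBall c R, ‖x - ballProj c R x‖ ≤ ‖x - y‖ := by
  unfold ballProj
  split_ifs with h
  · exact ⟨by simpa [Metric.mem_closedBall, dist_eq_norm] using h, fun y _ => by simp⟩
  · push Not at h
    have hpos : 0 < ‖x - c‖ := lt_of_le_of_lt hR h
    refine ⟨?_, fun y hy => ?_⟩
    · simp only [Metric.mem_closedBall, dist_eq_norm, add_sub_cancel_left, norm_smul, norm_div,
        norm_norm, Real.norm_of_nonneg hR]
      rw [div_mul_cancel₀ _ hpos.ne']
    · have e1 : x - (c + (R / ‖x - c‖) • (x - c)) = (1 - R / ‖x - c‖) • (x - c) := by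
        rw [sub_smul, one_smul]; abel
      have h1 : R / ‖x - c‖ ≤ 1 := (div_le_one hpos).2 h.le
      rw [e1, norm_smul, Real.norm_of_nonneg (by linarith), sub_mul, one_mul,
        div_mul_cancel₀ _ hpos.ne']
      have hy' : ‖y - c‖ ≤ R := by simpa [Metric.mem_closedBall, dist_eq_norm] using hy
      have : ‖x - c‖ ≤ ‖x - y‖ + ‖y - c‖ := norm_sub_le_norm_sub_add_norm_sub x y c
      linarith

/-- The variance-reduced stochastic gradient
`∇ℓ(θ, ξʳ) - ∇ℓ(θ*, ξʳ) - r_f / (1 - r_f) ∇ℓ(θ*, ξᶠ)`. -/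
noncomputable def vrGrad (ℓ : E d → E s → ℝ) (rf : ℝ) (θs θ : E d) (ξr ξf : E s) : E d :=
  ∇ (fun x => ℓ x ξr) θ - ∇ (fun x => ℓ x ξr) θs - (rf / (1 - rf)) • ∇ (fun x => ℓ x ξf) θs

/-- The step number `t ≥ 1` of projected SGD, with step size `1 / (μ t)` and projection onto the
ball of radius `r_f / (1 - r_f) * L / μ` around `θ*`. -/
noncomputable def step (ℓ : E d → E s → ℝ) (μ L rf : ℝ) (θs : E d) (t : ℕ)
    (θ : E d) (ξr ξf : E s) : E d :=
  ballProj θs (rf / (1 - rf) * (L / μ)) (θ - (1 / (μ * t)) • vrGrad ℓ rf θs θ ξr ξf)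

/-- The law of the iterate after `T` steps, started at `θs`; every step draws
a fresh independent pair `(ξʳ, ξᶠ) ∼ 𝒟_r ⊗ 𝒟_f`. -/
noncomputable def iterLaw (ℓ : E d → E s → ℝ) (μ L rf : ℝ) (θs : E d) (Dr Df : Measure (E s)) :
    ℕ → Measure (E d)
  | 0 => Measure.dirac θs
  | t + 1 => ((iterLaw ℓ μ L rf θs Dr Df t).prod (Dr.prod Df)).map
      fun p => step ℓ μ L rf θs (t + 1) p.1 p.2.1 p.2.2

/-- The privacy budget `κ_{ε,δ} = ε⁻¹ √(2 log(2.5 / δ))`. -/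
noncomputable def kdp (ε δ : ℝ) : ℝ := ε⁻¹ * √(2 * Real.log (2.5 / δ))

/-- `h(T, δ) = 1 + 624 (log log T + log(2 / δ))`. -/
noncomputable def h (T : ℕ) (δ : ℝ) : ℝ :=
  1 + 624 * (Real.log (Real.log T) + Real.log (2 / δ))

/-- `ν_T = √(2 h(T, δ)) L (1 + β / μ) / (μ √T)`. -/
noncomputable def nu (μ β L δ : ℝ) (T : ℕ) : ℝ :=
  √(2 * h T δ) * L * ((1 + β / μ) / (μ * √(T : ℝ)))

/-- The law of the output `θ_T + r_f / (1 - r_f) ν_T κ_{ε,δ} Z` of the algorithm with horizon `T`,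
where `Z` is a standard Gaussian vector of `ℝᵈ` independent of `θ_T`. It is meant for `T ≥ 2`:
for `T ≤ 1` the quantity `log log T` is undefined. -/
noncomputable def vru (ℓ : E d → E s → ℝ) (μ β L rf ε δ : ℝ) (T : ℕ) (Dr Df : Measure (E s)) :
    Measure (E d) :=
  ((iterLaw ℓ μ L rf (trained ℓ rf Dr Df) Dr Df T).prod (stdGaussian (E d))).map
    fun p => p.1 + (rf / (1 - rf) * nu μ β L δ T * kdp ε δ) • p.2

/-- `(ε, δ)`-unlearning for a randomized algorithm `U`, given by its output law as a function of
the retain and forget distributions, which range over the pairs satisfying `adm`: the output is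
`(ε, δ)`-indistinguishable from that of a retraining algorithm `A` that only sees the retain
distribution. -/
def IsUnlearning (adm : Measure (E s) → Measure (E s) → Prop)
    (U : Measure (E s) → Measure (E s) → Measure (E d)) (ε δ : ℝ) : Prop :=
  ∃ A : Measure (E s) → Measure (E d), (∀ Dr, IsProbabilityMeasure (A Dr)) ∧
    ∀ Dr Df, adm Dr Df → IsProbabilityMeasure (U Dr Df) ∧ ∀ S, MeasurableSet S →
      U Dr Df S ≤ ENNReal.ofReal (Real.exp ε) * A Dr S + ENNReal.ofReal δ ∧
      A Dr S ≤ ENNReal.ofReal (Real.exp ε) * U Dr Df S + ENNReal.ofReal δ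

/-- The convergence time: the least horizon `T ≥ 2` for which the output of law `U T` has
expected excess retain risk at most `e` (`⊤` if there is none). -/
noncomputable def convergenceTime (ℓ : E d → E s → ℝ) (Dr : Measure (E s))
    (U : ℕ → Measure (E d)) (e : ℝ) : ℕ∞ :=
  ⨅ T ∈ {T : ℕ | 2 ≤ T ∧
    Integrable (fun θ => risk ℓ Dr θ - risk ℓ Dr (argMin (risk ℓ Dr))) (U T) ∧
    ∫ θ, (risk ℓ Dr θ - risk ℓ Dr (argMin (risk ℓ Dr))) ∂(U T) ≤ e}, (T : ℕ∞)

/-- The complexity `κ³ (1 + d κ_{ε,δ}² log(1 / δ)) (e₀ / e) (r_f / (1 - r_f))²`, where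
`κ = β / μ` is the condition number and `e₀ = L² / μ` the reference error. -/
noncomputable def complexity (d : ℕ) (μ β L rf ε δ e : ℝ) : ℝ :=
  (β / μ) ^ 3 * (1 + d * kdp ε δ ^ 2 * Real.log (1 / δ)) * (L ^ 2 / μ / e) * (rf / (1 - rf)) ^ 2

end Definitions

end VRU

/-!
The iterates of the variance-reduced algorithm are those of stochastic gradient descent on the
retain risk. Stationarity of the trained model for the mixture (`Admissible.meanGrad_trained`)
makes the stochastic gradient unbiased for the retain risk (`Admissible.integral_vrGrad`), and it
also puts the retrained model, the minimizer of the retain risk, inside the ball onto which the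
iterates are projected (`Admissible.norm_trained_sub_argMin_le`). In that ball the stochastic
gradients are bounded by `G = r_f / (1 - r_f) L (1 + β / μ)`.

The core estimate is `Admissible.lintegral_exp_potential_le`: if `Y` is the squared distance of
the iterate to the retrained model in units of `G² / μ²`, then `𝔼 exp (t Y / 4) ≤ exp (1 / 2)`
after `t ≥ 1` steps. Conditionally on the past, Hoeffding's lemma controls the exponential moment
of the noise along the direction to the minimizer, and the contraction of `Y` by `1 - 2 / t` from
strong convexity dominates both that variance term and the growth of the factor `t / 4`. Convexity
of the exponential (`lintegral_exp_mul_le`) turns the excess contraction into a bound uniform in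
`t`. The argument yields a stronger tail than the calibration of the noise requires, without any
`log log T`.

For unlearning, the retraining algorithm outputs the minimizer of the retain risk plus the same
Gaussian noise. By Markov's inequality the last iterate is, up to probability `δ / 2`, within the
distance for which the Gaussian mechanism (`gaussianAt_le`) guarantees indistinguishability at
level `(ε, δ / 2)`. The mechanism rests on the Cameron–Martin formula `stdGaussian_map_add`.

For convergence, the excess risk is at most `β` times the squared distance to the minimizer, whose
mean is of order `G² / (μ² T) (1 + d h(T, δ) κ_{ε,δ}²)`. Solving for `T` is `exists_horizon`; the
factor `log log (16 + X)` comes from the `log log T` in `h(T, δ)`.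
-/

namespace VRU

/-! ### The Gaussian mechanism -/

theorem integral_stdGaussian_prod {d : ℕ} (f : Fin d → ℝ → ℂ)
    (hf : ∀ i, Measurable (f i)) :
    ∫ x, ∏ i, f i (x i) ∂(stdGaussian (E d)) = ∏ i, ∫ y, f i y ∂(gaussianReal 0 1) := by
  rw [← map_pi_eq_stdGaussian, integral_map (by fun_prop)]
  · exact integral_fintype_prod_eq_prod (𝕜 := ℂ) f
  · refine Measurable.aestronglyMeasurable (Finset.measurable_prod _ fun i _ => ?_)
    exact (hf i).comp (by fun_prop)

theorem integrable_exp_inner_stdGaussian {d : ℕ} (a : E d) :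
    Integrable (fun x => Real.exp (⟪a, x⟫ - ‖a‖ ^ 2 / 2)) (stdGaussian (E d)) := by
  rw [← map_pi_eq_stdGaussian, integrable_map_measure (by fun_prop) (by fun_prop)]
  have h := Integrable.fintype_prod (μ := fun _ : Fin d => gaussianReal 0 1)
    (f := fun i y => Real.exp (a i * y)) (fun i => integrable_exp_mul_gaussianReal (a i))
  refine (h.mul_const (Real.exp (-(‖a‖ ^ 2 / 2)))).congr (ae_of_all _ fun x => ?_)
  simp only [Function.comp, ← Real.exp_sum, ← Real.exp_add, PiLp.inner_apply, sub_eq_add_neg]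
  simp [mul_comm]

/-- **Cameron–Martin**: translating the standard Gaussian measure by `a` multiplies it by the
density `x ↦ exp (⟪a, x⟫ - ‖a‖² / 2)`. -/
theorem stdGaussian_map_add {d : ℕ} (a : E d) :
    (stdGaussian (E d)).map (fun x => a + x) =
      (stdGaussian (E d)).withDensity
        fun x => ENNReal.ofReal (Real.exp (⟪a, x⟫ - ‖a‖ ^ 2 / 2)) := by
  have hfin : IsFiniteMeasure ((stdGaussian (E d)).withDensity
      fun x => ENNReal.ofReal (Real.exp (⟪a, x⟫ - ‖a‖ ^ 2 / 2))) :=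
    isFiniteMeasure_withDensity_ofReal (integrable_exp_inner_stdGaussian a).2
  have hp : IsProbabilityMeasure ((stdGaussian (E d)).map (fun x => a + x)) :=
    Measure.isProbabilityMeasure_map (by fun_prop)
  refine Measure.ext_of_charFun ?_
  ext t
  rw [charFun_map_const_add, charFun_stdGaussian, charFun_apply,
    integral_withDensity_eq_integral_toReal_smul (by fun_prop) (by simp)]
  -- The right-hand side is a product of complex moment generating functions, at `a i + t i I`.
  have key : ∀ x : E d, (ENNReal.ofReal (Real.exp (⟪a, x⟫ - ‖a‖ ^ 2 / 2))).toReal •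
      Complex.exp ((⟪x, t⟫ : ℝ) * Complex.I) =
      Complex.exp (-(‖a‖ ^ 2 / 2 : ℝ)) *
        ∏ i, Complex.exp ((a i + t i * Complex.I) * (x i : ℝ)) := by
    intro x
    rw [ENNReal.toReal_ofReal (Real.exp_pos _).le, Complex.real_smul, Complex.ofReal_exp,
      ← Complex.exp_sum, ← Complex.exp_add, ← Complex.exp_add]
    congr 1
    simp only [PiLp.inner_apply, add_mul, Finset.sum_add_distrib]
    have hsum : ∑ i, (t i : ℂ) * Complex.I * x i = (∑ i, (t i : ℂ) * x i) * Complex.I := by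
      rw [Finset.sum_mul]
      exact Finset.sum_congr rfl fun i _ => by ring
    rw [hsum]
    simp [mul_comm]
    ring
  simp_rw [key]
  rw [integral_const_mul, integral_stdGaussian_prod
    (fun i y => Complex.exp ((a i + t i * Complex.I) * (y : ℝ))) (by fun_prop)]
  have h1 : ∀ z : ℂ, ∫ y, Complex.exp (z * (y : ℝ)) ∂(gaussianReal 0 1) =
      Complex.exp (z ^ 2 / 2) := by
    intro z
    have := complexMGF_id_gaussianReal (μ := 0) (v := 1) z
    simpa [complexMGF] using this
  simp_rw [h1]
  rw [← Complex.exp_sum, ← Complex.exp_add, ← Complex.exp_add]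
  congr 1
  have hI : ∀ i, ((a i : ℂ) + t i * Complex.I) ^ 2 / 2 =
      ((a i ^ 2 / 2 - t i ^ 2 / 2 : ℝ) : ℂ) + ((t i * a i : ℝ) : ℂ) * Complex.I := by
    intro i
    have := Complex.I_sq
    push_cast
    linear_combination ((t i : ℂ) ^ 2 / 2) * this
  simp_rw [hI]
  rw [Finset.sum_add_distrib, ← Finset.sum_mul, ← Complex.ofReal_sum, ← Complex.ofReal_sum,
    Finset.sum_sub_distrib, ← Finset.sum_div, ← Finset.sum_div, EuclideanSpace.real_norm_sq_eq,
    ← EuclideanSpace.real_norm_sq_eq t]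
  simp [PiLp.inner_apply]
  ring

theorem stdGaussian_map_neg {d : ℕ} :
    (stdGaussian (E d)).map (fun x => -x) = stdGaussian (E d) :=
  stdGaussian_map (LinearIsometryEquiv.neg ℝ)

theorem stdGaussian_inner_pos_le {d : ℕ} (a : E d) :
    stdGaussian (E d) {x | 0 < ⟪a, x⟫} ≤ 2⁻¹ := by
  have hm : MeasurableSet {x : E d | 0 < ⟪a, x⟫} := measurableSet_lt (by fun_prop) (by fun_prop)
  have h1 : stdGaussian (E d) {x | ⟪a, x⟫ < 0} = stdGaussian (E d) {x | 0 < ⟪a, x⟫} := by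
    conv_rhs => rw [← stdGaussian_map_neg, Measure.map_apply (by fun_prop) hm]
    simp
  have h2 : stdGaussian (E d) {x | 0 < ⟪a, x⟫} + stdGaussian (E d) {x | ⟪a, x⟫ < 0} ≤ 1 := by
    rw [← measure_union _ (measurableSet_lt (by fun_prop) (by fun_prop))]
    · exact prob_le_one
    · rw [Set.disjoint_left]
      intro x h3 h4
      exact lt_asymm (show 0 < ⟪a, x⟫ from h3) h4
  rw [h1, ← two_mul] at h2
  rw [mul_comm] at h2
  exact (ENNReal.le_inv_iff_mul_le).2 h2

/-- Gaussian tail bound in the direction `a`. The factor `1 / 2`, which comes from the symmetry of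
the half-space, is what makes the constant `1.25` of the Gaussian mechanism suffice. -/
theorem stdGaussian_tail_le {d : ℕ} {a : E d} (ha : a ≠ 0) {t : ℝ} (ht : 0 ≤ t) :
    stdGaussian (E d) {x | t * ‖a‖ < ⟪a, x⟫} ≤ ENNReal.ofReal (Real.exp (-(t ^ 2 / 2)) / 2) := by
  have hpos : 0 < ‖a‖ := norm_pos_iff.2 ha
  set b : E d := (t / ‖a‖) • a with hb
  have hab : ⟪a, b⟫ = t * ‖a‖ := by
    rw [hb, real_inner_smul_right, real_inner_self_eq_norm_sq]; field_simp
  have hbn : ‖b‖ = t := by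
    rw [hb, norm_smul, Real.norm_of_nonneg (by positivity)]; field_simp
  have hm : MeasurableSet {x : E d | 0 < ⟪a, x⟫} := measurableSet_lt (by fun_prop) (by fun_prop)
  have h1 : {x : E d | t * ‖a‖ < ⟪a, x⟫} = (fun x => -b + x) ⁻¹' {x | 0 < ⟪a, x⟫} := by
    ext x
    simp [inner_add_right, hab]
  rw [h1, ← Measure.map_apply (by fun_prop) hm, stdGaussian_map_add, withDensity_apply _ hm]
  calc ∫⁻ x in {x : E d | 0 < ⟪a, x⟫},
        ENNReal.ofReal (Real.exp (⟪-b, x⟫ - ‖-b‖ ^ 2 / 2)) ∂(stdGaussian (E d))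
      ≤ ∫⁻ _ in {x : E d | 0 < ⟪a, x⟫},
        ENNReal.ofReal (Real.exp (-(t ^ 2 / 2))) ∂(stdGaussian (E d)) := by
        refine setLIntegral_mono (by fun_prop) fun x hx => ?_
        refine ENNReal.ofReal_le_ofReal (Real.exp_le_exp.2 ?_)
        have : 0 ≤ ⟪b, x⟫ := by
          rw [hb, real_inner_smul_left]
          exact mul_nonneg (by positivity) (le_of_lt hx)
        rw [norm_neg, hbn, inner_neg_left]
        linarith
    _ ≤ ENNReal.ofReal (Real.exp (-(t ^ 2 / 2))) * 2⁻¹ := by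
        rw [setLIntegral_const]
        gcongr
        exact stdGaussian_inner_pos_le a
    _ = ENNReal.ofReal (Real.exp (-(t ^ 2 / 2)) / 2) := by
        rw [ENNReal.ofReal_div_of_pos (by norm_num), ENNReal.div_eq_inv_mul, mul_comm]
        simp

theorem exp_half_le_two : Real.exp (1 / 2) ≤ 2 := by
  have h : Real.exp (1 / 2) * Real.exp (1 / 2) = Real.exp 1 := by
    rw [← Real.exp_add]; norm_num
  nlinarith [Real.exp_one_lt_d9, Real.exp_pos (1 / 2)]

/-- The tail bound at the level where the privacy loss of a shift by `a`, with
`‖a‖ ≤ ε / √(2 log (2.5 / δ))`, exceeds `ε`. -/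
theorem stdGaussian_privacy_loss_le {d : ℕ} {a : E d} {ε δ : ℝ} (hε : 0 < ε) (hε1 : ε ≤ 1)
    (hδ : 0 < δ) (hδ1 : δ < 1) (ha : ‖a‖ * kdp ε δ ≤ 1) :
    stdGaussian (E d) {x | ε - ‖a‖ ^ 2 / 2 < ⟪a, x⟫} ≤ ENNReal.ofReal (δ / 2) := by
  have hlog : (9 : ℝ) / 10 < Real.log (2.5 / δ) := by
    have h1 : (5 : ℝ) / 2 ≤ 2.5 / δ := by
      rw [le_div_iff₀ hδ]; linarith
    have h2 : (9 : ℝ) / 10 < Real.log (5 / 2) := by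
      rw [Real.lt_log_iff_exp_lt (by norm_num)]
      have h3 := Real.exp_one_lt_d9
      have h4 : Real.exp (9 / 10) * (11 / 10) ≤ Real.exp 1 := by
        have : (11 : ℝ) / 10 ≤ Real.exp (1 / 10) := by
          have := Real.add_one_le_exp (1 / 10 : ℝ); linarith
        calc Real.exp (9 / 10) * (11 / 10) ≤ Real.exp (9 / 10) * Real.exp (1 / 10) := by gcongr
          _ = Real.exp 1 := by rw [← Real.exp_add]; norm_num
      linarith
    exact h2.trans_le (Real.log_le_log (by norm_num) h1)
  by_cases h0 : a = 0
  · subst h0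
    have : {x : E d | ε - ‖(0 : E d)‖ ^ 2 / 2 < ⟪(0 : E d), x⟫} = ∅ := by
      ext x; simp [hε.le]
    rw [this]; simp
  have hpos : 0 < ‖a‖ := norm_pos_iff.2 h0
  set c : ℝ := √(2 * Real.log (2.5 / δ)) with hc
  have hc2 : c ^ 2 = 2 * Real.log (2.5 / δ) := Real.sq_sqrt (by linarith)
  have hc1 : 1 < c := by
    rw [hc, Real.lt_sqrt (by norm_num)]; linarith
  have hac : ‖a‖ * c ≤ ε := by
    have : kdp ε δ = ε⁻¹ * c := rfl
    rw [this] at ha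
    have h2 := mul_le_mul_of_nonneg_right ha hε.le
    have h3 : ‖a‖ * (ε⁻¹ * c) * ε = ‖a‖ * c := by field_simp
    linarith
  set t : ℝ := c - 1 / (2 * c) with ht
  have hcc : c * (1 / (2 * c)) = 1 / 2 := by field_simp
  have hinv : 1 / (2 * c) ≤ 1 / 2 := by
    apply div_le_div_of_nonneg_left <;> linarith
  have ht0 : 0 ≤ t := by linarith
  have hta : t * ‖a‖ ≤ ε - ‖a‖ ^ 2 / 2 := by
    -- `‖a‖ ≤ ε / c ≤ 1 / c`
    have h1 : ‖a‖ ≤ 1 / c := by rw [le_div_iff₀ (by linarith)]; linarith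
    have h2 : 1 / c = 2 * (1 / (2 * c)) := by field_simp
    nlinarith
  refine (measure_mono (fun x (hx : _ < _) => lt_of_le_of_lt hta hx)).trans
    ((stdGaussian_tail_le h0 ht0).trans (ENNReal.ofReal_le_ofReal ?_))
  have h5 : c ^ 2 - 1 ≤ t ^ 2 := by
    have : t ^ 2 = c ^ 2 - 2 * (c * (1 / (2 * c))) + (1 / (2 * c)) ^ 2 := by rw [ht]; ring
    rw [this, hcc]
    nlinarith [sq_nonneg (1 / (2 * c))]
  have h6 : Real.exp (-(t ^ 2 / 2)) ≤ Real.exp (1 / 2) * (δ / 2.5) := by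
    calc Real.exp (-(t ^ 2 / 2)) ≤ Real.exp (1 / 2 - Real.log (2.5 / δ)) := by
          apply Real.exp_le_exp.2; linarith
      _ = Real.exp (1 / 2) * (δ / 2.5) := by
          rw [Real.exp_sub, Real.exp_log (by positivity)]
          field_simp
  have h7 := exp_half_le_two
  have h10 : Real.exp (1 / 2) * (δ / 2.5) ≤ 2 * (δ / 2.5) := by gcongr
  norm_num at h10 h6
  linarith

theorem kdp_pos {ε δ : ℝ} (hε : 0 < ε) (hδ : 0 < δ) (hδ1 : δ < 1) : 0 < kdp ε δ := by
  refine mul_pos (inv_pos.2 hε) (Real.sqrt_pos.2 (mul_pos two_pos (Real.log_pos ?_)))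
  rw [lt_div_iff₀ hδ]; linarith

/-- The law of `u + σ Z` for a standard Gaussian vector `Z`. -/
noncomputable def gaussianAt {d : ℕ} (σ : ℝ) (u : E d) : Measure (E d) :=
  (stdGaussian (E d)).map fun x => u + σ • x

instance {d : ℕ} (σ : ℝ) (u : E d) : IsProbabilityMeasure (gaussianAt σ u) :=
  Measure.isProbabilityMeasure_map (by fun_prop)

/-- The **Gaussian mechanism**: Gaussian noise of scale `Δ κ_{ε,δ}` makes points at distance at most
`Δ` indistinguishable at level `(ε, δ / 2)`. -/
theorem gaussianAt_le {d : ℕ} {ε δ Δ : ℝ} (hε : 0 < ε) (hε1 : ε ≤ 1)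
    (hδ : 0 < δ) (hδ1 : δ < 1) (hΔ : 0 < Δ) {u v : E d} (huv : ‖u - v‖ ≤ Δ) {S : Set (E d)}
    (hS : MeasurableSet S) :
    gaussianAt (Δ * kdp ε δ) u S ≤
      ENNReal.ofReal (Real.exp ε) * gaussianAt (Δ * kdp ε δ) v S + ENNReal.ofReal (δ / 2) := by
  have hk : 0 < kdp ε δ := kdp_pos hε hδ hδ1
  set σ := Δ * kdp ε δ with hσ
  have hσ0 : 0 < σ := mul_pos hΔ hk
  set a : E d := σ⁻¹ • (u - v) with ha
  have han : ‖a‖ * kdp ε δ ≤ 1 := by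
    rw [ha, norm_smul, Real.norm_of_nonneg (inv_nonneg.2 hσ0.le), hσ]
    calc (Δ * kdp ε δ)⁻¹ * ‖u - v‖ * kdp ε δ = ‖u - v‖ / Δ := by field_simp
      _ ≤ 1 := (div_le_one hΔ).2 huv
  -- In the coordinates `(x - v) / σ` the two laws are the standard Gaussian and its shift by `a`.
  set S' : Set (E d) := (fun x => v + σ • x) ⁻¹' S with hS'
  have hS'm : MeasurableSet S' := (by fun_prop : Measurable fun x : E d => v + σ • x) hS
  have e1 : gaussianAt σ v S = stdGaussian (E d) S' := by
    rw [gaussianAt, Measure.map_apply (by fun_prop) hS]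
  have e2 : gaussianAt σ u S = (stdGaussian (E d)).map (fun x => a + x) S' := by
    rw [gaussianAt, Measure.map_apply (by fun_prop) hS, Measure.map_apply (by fun_prop) hS'm]
    congr 1
    ext x
    simp [hS', ha, smul_smul, hσ0.ne']
    rw [← add_assoc, add_sub_cancel]
  rw [e1, e2]
  set B : Set (E d) := {x | ε < ⟪a, x⟫ - ‖a‖ ^ 2 / 2} with hB
  have hBm : MeasurableSet B := measurableSet_lt (by fun_prop) (by fun_prop)
  have h1 : (stdGaussian (E d)).map (fun x => a + x) (S' \ B) ≤
      ENNReal.ofReal (Real.exp ε) * stdGaussian (E d) S' := by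
    rw [stdGaussian_map_add, withDensity_apply _ (hS'm.diff hBm)]
    calc ∫⁻ x in S' \ B, ENNReal.ofReal (Real.exp (⟪a, x⟫ - ‖a‖ ^ 2 / 2)) ∂(stdGaussian (E d))
        ≤ ∫⁻ _ in S' \ B, ENNReal.ofReal (Real.exp ε) ∂(stdGaussian (E d)) := by
          refine setLIntegral_mono (by fun_prop) fun x hx => ?_
          exact ENNReal.ofReal_le_ofReal (Real.exp_le_exp.2 (not_lt.1 hx.2))
      _ ≤ _ := by
          rw [setLIntegral_const]
          gcongr
          exact Set.sdiff_subset
  have h2 : (stdGaussian (E d)).map (fun x => a + x) B ≤ ENNReal.ofReal (δ / 2) := by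
    rw [Measure.map_apply (by fun_prop) hBm]
    refine le_trans (measure_mono fun x hx => ?_) (stdGaussian_privacy_loss_le hε hε1 hδ hδ1 han)
    have h3 : ε < ⟪a, a + x⟫ - ‖a‖ ^ 2 / 2 := hx
    rw [inner_add_right, real_inner_self_eq_norm_sq] at h3
    show ε - ‖a‖ ^ 2 / 2 < ⟪a, x⟫
    linarith
  calc (stdGaussian (E d)).map (fun x => a + x) S'
      ≤ (stdGaussian (E d)).map (fun x => a + x) (S' \ B ∪ B) := by
        apply measure_mono
        rw [Set.sdiff_union_self]
        exact Set.subset_union_left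
    _ ≤ _ := (measure_union_le _ _).trans (add_le_add h1 h2)

theorem integrable_norm_sq_stdGaussian {d : ℕ} :
    Integrable (fun x => ‖x‖ ^ 2) (stdGaussian (E d)) := by
  have h : MemLp id 2 (stdGaussian (E d)) := IsGaussian.memLp_two_id
  exact h.integrable_norm_pow (by norm_num)

theorem integral_norm_sq_stdGaussian {d : ℕ} : ∫ x, ‖x‖ ^ 2 ∂(stdGaussian (E d)) = d := by
  have h : MemLp id 2 (stdGaussian (E d)) := IsGaussian.memLp_two_id
  have h1 : ∀ i, MemLp (fun x : E d => x i) 2 (stdGaussian (E d)) := fun i =>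
    h.continuousLinearMap_comp (EuclideanSpace.proj i : E d →L[ℝ] ℝ)
  simp_rw [EuclideanSpace.real_norm_sq_eq]
  rw [integral_finsetSum _ fun i _ => (h1 i).integrable_sq]
  have h2 : ∀ i, ∫ x : E d, x i ^ 2 ∂(stdGaussian (E d)) = 1 := by
    intro i
    rw [← map_pi_eq_stdGaussian, integral_map (by fun_prop) (by fun_prop)]
    have h3 := measurePreserving_eval (fun _ : Fin d => gaussianReal 0 1) i
    have h4 : ∫ x : ℝ, x ^ 2 ∂(gaussianReal 0 1) = 1 := by
      have := variance_id_gaussianReal (μ := 0) (v := 1)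
      rw [variance_of_integral_eq_zero (by fun_prop) (by simp)] at this
      simpa using this
    rw [← h4]
    conv_rhs => rw [← h3.map_eq, integral_map h3.measurable.aemeasurable (by fun_prop)]
  simp [h2]

/-! ### Gradients of the sample losses -/

/-- The gradient `∇ℓ(θ, ξ)` of the loss in the parameter. -/
noncomputable def lossGrad {d s : ℕ} (ℓ : E d → E s → ℝ) (θ : E d) (ξ : E s) : E d :=
  ∇ (fun x => ℓ x ξ) θ

/-- The mean gradient `𝔼_{ξ ∼ D} ∇ℓ(θ, ξ)`. For integrable regular losses it is the gradient of the
risk, but only first-order inequalities are used, never differentiation under the integral. -/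
noncomputable def meanGrad {d s : ℕ} (ℓ : E d → E s → ℝ) (D : Measure (E s)) (θ : E d) : E d :=
  ∫ ξ, lossGrad ℓ θ ξ ∂D

namespace IsRegularLoss

variable {d s : ℕ} {ℓ : E d → E s → ℝ} {Θ : Set (E d)} {μ β L : ℝ}

theorem le_lossGrad (hℓ : IsRegularLoss ℓ Θ μ β L) (ξ : E s) (θ θ' : E d) :
    ℓ θ ξ + ⟪lossGrad ℓ θ ξ, θ' - θ⟫ + μ / 2 * ‖θ' - θ‖ ^ 2 ≤ ℓ θ' ξ :=
  hℓ.strongly_convex ξ θ θ'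

theorem lossGrad_lipschitz (hℓ : IsRegularLoss ℓ Θ μ β L) (ξ : E s) (θ θ' : E d) :
    ‖lossGrad ℓ θ ξ - lossGrad ℓ θ' ξ‖ ≤ β * ‖θ - θ'‖ :=
  hℓ.smooth ξ θ θ'

theorem continuous_lossGrad (hℓ : IsRegularLoss ℓ Θ μ β L) (ξ : E s) :
    Continuous fun θ => lossGrad ℓ θ ξ := by
  have : LipschitzWith β.toNNReal fun θ => lossGrad ℓ θ ξ := by
    refine LipschitzWith.of_dist_le_mul fun θ θ' => ?_
    rw [dist_eq_norm, dist_eq_norm, Real.coe_toNNReal _ hℓ.beta_pos.le]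
    exact hℓ.lossGrad_lipschitz ξ θ θ'
  exact this.continuous

/-- The coordinates of the gradient are limits of difference quotients. -/
theorem measurable_lossGrad (hℓ : IsRegularLoss ℓ Θ μ β L) (θ : E d) :
    Measurable (lossGrad ℓ θ) := by
  have hcoord : ∀ i : Fin d, Measurable fun ξ => (lossGrad ℓ θ ξ) i := by
    intro i
    have hlim : ∀ ξ, Filter.Tendsto
        (fun n : ℕ => (n : ℝ) * (ℓ (θ + (n : ℝ)⁻¹ • EuclideanSpace.single i 1) ξ - ℓ θ ξ))
        Filter.atTop (nhds ((lossGrad ℓ θ ξ) i)) := by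
      intro ξ
      have h1 := ((hℓ.differentiable ξ) θ).hasGradientAt.hasFDerivAt.lim_real
        (EuclideanSpace.single i (1 : ℝ))
      have h2 := h1.comp tendsto_natCast_atTop_atTop
      rw [InnerProductSpace.toDual_apply_apply, EuclideanSpace.inner_single_right] at h2
      simpa [Function.comp_def, lossGrad] using h2
    refine measurable_of_tendsto_metrizable (fun n => ?_) (tendsto_pi_nhds.2 hlim)
    exact ((hℓ.measurable _).sub (hℓ.measurable _)).const_mul _
  have h : Measurable fun ξ => WithLp.toLp 2 fun i => (lossGrad ℓ θ ξ) i :=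
    (by fun_prop : Measurable (WithLp.toLp 2 : (Fin d → ℝ) → E d)).comp
      (measurable_pi_lambda _ hcoord)
  exact h

theorem measurable_uncurry_lossGrad (hℓ : IsRegularLoss ℓ Θ μ β L) :
    Measurable fun p : E d × E s => lossGrad ℓ p.1 p.2 :=
  measurable_uncurry_of_continuous_of_measurable (u := lossGrad ℓ)
    (fun ξ => hℓ.continuous_lossGrad ξ) hℓ.measurable_lossGrad

theorem norm_lossGrad_le (hℓ : IsRegularLoss ℓ Θ μ β L) {θ : E d} (hθ : θ ∈ interior Θ) (ξ : E s) :
    ‖lossGrad ℓ θ ξ‖ ≤ L := by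
  have h1 := ((hℓ.differentiable ξ) θ).hasGradientAt.hasFDerivAt
  have h2 := h1.le_of_lip' hℓ.lip_pos.le (by
    filter_upwards [mem_interior_iff_mem_nhds.1 hθ] with x hx
    rw [Real.norm_eq_abs]
    exact hℓ.lipschitz ξ x hx θ (interior_subset hθ))
  rwa [LinearIsometryEquiv.norm_map] at h2

/-- A form of the descent lemma with `β` in place of `β / 2`, which needs only convexity and the
Lipschitz bound on the gradient. -/
theorem loss_le (hℓ : IsRegularLoss ℓ Θ μ β L) (ξ : E s) (θ θ' : E d) :
    ℓ θ' ξ ≤ ℓ θ ξ + ⟪lossGrad ℓ θ ξ, θ' - θ⟫ + β * ‖θ' - θ‖ ^ 2 := by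
  have h1 := hℓ.le_lossGrad ξ θ' θ
  have h2 : ⟪lossGrad ℓ θ' ξ - lossGrad ℓ θ ξ, θ' - θ⟫ ≤ β * ‖θ' - θ‖ ^ 2 :=
    calc _ ≤ ‖lossGrad ℓ θ' ξ - lossGrad ℓ θ ξ‖ * ‖θ' - θ‖ := real_inner_le_norm _ _
      _ ≤ β * ‖θ' - θ‖ * ‖θ' - θ‖ := by gcongr; exact hℓ.lossGrad_lipschitz ξ θ' θ
      _ = _ := by ring
  rw [inner_sub_left] at h2
  have h3 : ⟪lossGrad ℓ θ' ξ, θ - θ'⟫ = -⟪lossGrad ℓ θ' ξ, θ' - θ⟫ := by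
    rw [← inner_neg_right, neg_sub]
  have h4 : 0 ≤ μ / 2 * ‖θ - θ'‖ ^ 2 := by have := hℓ.mu_pos; positivity
  linarith

theorem mu_le_beta (hℓ : IsRegularLoss ℓ Θ μ β L) (hd : d ≠ 0) : μ ≤ β := by
  have : Nonempty (Fin d) := ⟨⟨0, Nat.pos_of_ne_zero hd⟩⟩
  obtain ⟨v, hv⟩ := exists_ne (0 : E d)
  have h1 := hℓ.le_lossGrad 0 0 v
  have h2 := hℓ.le_lossGrad 0 v 0
  have h3 : ⟪lossGrad ℓ v (0 : E s) - lossGrad ℓ 0 0, v⟫ ≤ β * ‖v‖ ^ 2 :=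
    calc _ ≤ ‖lossGrad ℓ v (0 : E s) - lossGrad ℓ 0 0‖ * ‖v‖ := real_inner_le_norm _ _
      _ ≤ β * ‖v - 0‖ * ‖v‖ := by gcongr; exact hℓ.lossGrad_lipschitz 0 v 0
      _ = _ := by rw [sub_zero]; ring
  rw [inner_sub_left] at h3
  simp only [sub_zero, zero_sub, inner_neg_right, norm_neg] at h1 h2
  have hv' : 0 < ‖v‖ ^ 2 := by positivity
  exact le_of_mul_le_mul_right (by linarith) hv'

/-! ### The risk and its minimizers -/

variable {D : Measure (E s)}

theorem integrable_lossGrad (hℓ : IsRegularLoss ℓ Θ μ β L) (hD : ∀ θ, Integrable (ℓ θ) D)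
    (θ : E d) : Integrable (lossGrad ℓ θ) D := by
  have hcoord : ∀ v : E d, Integrable (fun ξ => ⟪lossGrad ℓ θ ξ, v⟫) D := by
    intro v
    -- By convexity a directional derivative lies between two difference quotients.
    refine Integrable.mono' (((hD (θ + v)).sub (hD θ)).norm.add ((hD θ).sub (hD (θ - v))).norm)
      ((hℓ.measurable_lossGrad θ).inner_const).aestronglyMeasurable (ae_of_all _ fun ξ => ?_)
    have h1 := hℓ.le_lossGrad ξ θ (θ + v)
    have h2 := hℓ.le_lossGrad ξ θ (θ - v)
    have h3 : 0 ≤ μ / 2 * ‖v‖ ^ 2 := by have := hℓ.mu_pos; positivity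
    simp only [add_sub_cancel_left, sub_sub_cancel_left, inner_neg_right, norm_neg] at h1 h2
    simp only [Pi.add_apply, Pi.sub_apply, Real.norm_eq_abs]
    rw [abs_le]
    constructor
    · linarith [neg_abs_le (ℓ θ ξ - ℓ (θ - v) ξ), abs_nonneg (ℓ (θ + v) ξ - ℓ θ ξ)]
    · linarith [le_abs_self (ℓ (θ + v) ξ - ℓ θ ξ), abs_nonneg (ℓ θ ξ - ℓ (θ - v) ξ)]
  have h : Integrable (fun ξ => ∑ i, ⟪lossGrad ℓ θ ξ, EuclideanSpace.single i (1 : ℝ)⟫ •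
      (EuclideanSpace.single i (1 : ℝ) : E d)) D :=
    integrable_finsetSum _ fun i _ => (hcoord _).smul_const _
  refine h.congr (ae_of_all _ fun ξ => ?_)
  ext j
  simp [EuclideanSpace.inner_single_right, Pi.single_apply]

variable [IsProbabilityMeasure D]

theorem integral_linearization (hℓ : IsRegularLoss ℓ Θ μ β L)
    (hD : ∀ θ, Integrable (ℓ θ) D) (θ v : E d) (c : ℝ) :
    Integrable (fun ξ => ℓ θ ξ + ⟪lossGrad ℓ θ ξ, v⟫ + c) D ∧
      ∫ ξ, (ℓ θ ξ + ⟪lossGrad ℓ θ ξ, v⟫ + c) ∂D = risk ℓ D θ + ⟪meanGrad ℓ D θ, v⟫ + c := by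
  have hg := hℓ.integrable_lossGrad hD θ
  have hi : Integrable (fun ξ => ⟪lossGrad ℓ θ ξ, v⟫) D := hg.inner_const _
  have h1 : ∫ ξ, ⟪lossGrad ℓ θ ξ, v⟫ ∂D = ⟪meanGrad ℓ D θ, v⟫ := by
    simp_rw [real_inner_comm v]; exact integral_inner hg _
  have h2 : Integrable (fun ξ => ℓ θ ξ + ⟪lossGrad ℓ θ ξ, v⟫) D := (hD θ).add hi
  refine ⟨h2.add (integrable_const c), ?_⟩
  rw [integral_add h2 (integrable_const c), integral_add (hD θ) hi, h1]
  simp [risk]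

theorem risk_lower (hℓ : IsRegularLoss ℓ Θ μ β L) (hD : ∀ θ, Integrable (ℓ θ) D) (θ θ' : E d) :
    risk ℓ D θ + ⟪meanGrad ℓ D θ, θ' - θ⟫ + μ / 2 * ‖θ' - θ‖ ^ 2 ≤ risk ℓ D θ' := by
  obtain ⟨h1, h2⟩ := hℓ.integral_linearization hD θ (θ' - θ) (μ / 2 * ‖θ' - θ‖ ^ 2)
  rw [← h2]
  exact integral_mono h1 (hD θ') fun ξ => hℓ.le_lossGrad ξ θ θ'

theorem risk_upper (hℓ : IsRegularLoss ℓ Θ μ β L) (hD : ∀ θ, Integrable (ℓ θ) D) (θ θ' : E d) :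
    risk ℓ D θ' ≤ risk ℓ D θ + ⟪meanGrad ℓ D θ, θ' - θ⟫ + β * ‖θ' - θ‖ ^ 2 := by
  obtain ⟨h1, h2⟩ := hℓ.integral_linearization hD θ (θ' - θ) (β * ‖θ' - θ‖ ^ 2)
  rw [← h2]
  exact integral_mono (hD θ') h1 fun ξ => hℓ.loss_le ξ θ θ'

theorem mul_norm_sq_le_inner_meanGrad (hℓ : IsRegularLoss ℓ Θ μ β L)
    (hD : ∀ θ, Integrable (ℓ θ) D) (θ θ' : E d) :
    μ * ‖θ - θ'‖ ^ 2 ≤ ⟪meanGrad ℓ D θ - meanGrad ℓ D θ', θ - θ'⟫ := by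
  have h1 := hℓ.risk_lower hD θ θ'
  have h2 := hℓ.risk_lower hD θ' θ
  have h3 : ⟪meanGrad ℓ D θ, θ' - θ⟫ = -⟪meanGrad ℓ D θ, θ - θ'⟫ := by
    rw [← inner_neg_right, neg_sub]
  rw [inner_sub_left]
  rw [norm_sub_rev θ' θ, h3] at h1
  linarith

theorem continuous_risk (hℓ : IsRegularLoss ℓ Θ μ β L) (hD : ∀ θ, Integrable (ℓ θ) D) :
    Continuous (risk ℓ D) := by
  rw [continuous_iff_continuousAt]
  intro θ
  -- Near `θ` the risk is squeezed between two continuous functions that agree at `θ`.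
  refine tendsto_of_tendsto_of_tendsto_of_le_of_le
    (g := fun θ' => risk ℓ D θ + ⟪meanGrad ℓ D θ, θ' - θ⟫ + μ / 2 * ‖θ' - θ‖ ^ 2)
    (h := fun θ' => risk ℓ D θ + ⟪meanGrad ℓ D θ, θ' - θ⟫ + β * ‖θ' - θ‖ ^ 2)
    ?_ ?_ (fun θ' => hℓ.risk_lower hD θ θ') (fun θ' => hℓ.risk_upper hD θ θ')
  · exact Continuous.tendsto' (by fun_prop) _ _ (by simp)
  · exact Continuous.tendsto' (by fun_prop) _ _ (by simp)

theorem tendsto_risk_cocompact (hℓ : IsRegularLoss ℓ Θ μ β L) (hD : ∀ θ, Integrable (ℓ θ) D) :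
    Filter.Tendsto (risk ℓ D) (Filter.cocompact (E d)) Filter.atTop := by
  have hμ := hℓ.mu_pos
  have h1 : Filter.Tendsto (fun θ : E d => risk ℓ D 0 +
      ‖θ‖ * (μ / 2 * ‖θ‖ + -‖meanGrad ℓ D 0‖)) (Filter.cocompact (E d)) Filter.atTop := by
    have hn : Filter.Tendsto (fun θ : E d => ‖θ‖) (Filter.cocompact (E d)) Filter.atTop :=
      tendsto_norm_cocompact_atTop
    exact Filter.tendsto_atTop_add_const_left _ _ (hn.atTop_mul_atTop₀
      (Filter.tendsto_atTop_add_const_right _ _ (hn.const_mul_atTop (by positivity))))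
  refine Filter.tendsto_atTop_mono (fun θ => ?_) h1
  have h2 := hℓ.risk_lower hD 0 θ
  have h3 := neg_le_of_abs_le (abs_real_inner_le_norm (meanGrad ℓ D 0) θ)
  rw [sub_zero] at h2
  nlinarith

theorem isMinOn_argMin (hℓ : IsRegularLoss ℓ Θ μ β L) (hD : ∀ θ, Integrable (ℓ θ) D) :
    IsMinOn (risk ℓ D) Set.univ (argMin (risk ℓ D)) := by
  obtain ⟨θ, hθ⟩ := (hℓ.continuous_risk hD).exists_forall_le (hℓ.tendsto_risk_cocompact hD)
  exact Classical.epsilon_spec (p := fun θ => IsMinOn (risk ℓ D) Set.univ θ)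
    ⟨θ, fun y _ => hθ y⟩

theorem meanGrad_argMin (hℓ : IsRegularLoss ℓ Θ μ β L) (hD : ∀ θ, Integrable (ℓ θ) D) :
    meanGrad ℓ D (argMin (risk ℓ D)) = 0 := by
  set θ := argMin (risk ℓ D) with hθ
  set g := meanGrad ℓ D θ with hg
  have hβ := hℓ.beta_pos
  -- A gradient step of length `1 / (2 β)` would decrease the risk.
  have h1 : risk ℓ D θ ≤ risk ℓ D (θ - (1 / (2 * β)) • g) :=
    hℓ.isMinOn_argMin hD (Set.mem_univ (θ - (1 / (2 * β)) • g))
  have h2 := hℓ.risk_upper hD θ (θ - (1 / (2 * β)) • g)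
  rw [← hg, sub_sub_cancel_left, inner_neg_right, norm_neg, real_inner_smul_right, norm_smul,
    real_inner_self_eq_norm_sq, mul_pow, Real.norm_of_nonneg (by positivity)] at h2
  have h3 : β * ((1 / (2 * β)) ^ 2 * ‖g‖ ^ 2) = 1 / (4 * β) * ‖g‖ ^ 2 := by field_simp; ring
  have h4 : 1 / (2 * β) * ‖g‖ ^ 2 = 2 * (1 / (4 * β) * ‖g‖ ^ 2) := by field_simp; ring
  have h5 : 1 / (4 * β) * ‖g‖ ^ 2 ≤ 0 := by linarith
  have h6 : ‖g‖ ^ 2 ≤ 0 := by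
    by_contra h
    have : 0 < 1 / (4 * β) * ‖g‖ ^ 2 := mul_pos (by positivity) (not_le.1 h)
    linarith
  exact norm_eq_zero.1 (pow_eq_zero_iff two_ne_zero |>.1 (le_antisymm h6 (by positivity)))

theorem excess_le (hℓ : IsRegularLoss ℓ Θ μ β L) (hD : ∀ θ, Integrable (ℓ θ) D) (θ : E d) :
    risk ℓ D θ - risk ℓ D (argMin (risk ℓ D)) ≤ β * ‖θ - argMin (risk ℓ D)‖ ^ 2 := by
  have h := hℓ.risk_upper hD (argMin (risk ℓ D)) θ
  rw [hℓ.meanGrad_argMin hD, inner_zero_left] at h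
  linarith

end IsRegularLoss

/-! ### The trained model and the retrained model -/

namespace Admissible

variable {d s : ℕ} {ℓ : E d → E s → ℝ} {Θ : Set (E d)} {μ β L rf : ℝ} {Dr Df : Measure (E s)}

theorem isProbabilityMeasure_mixture (hD : Admissible ℓ Θ rf Dr Df) (h0 : 0 < rf) (h1 : rf < 1) :
    IsProbabilityMeasure (mixture rf Dr Df) := by
  have := hD.prob_retain
  have := hD.prob_forget
  refine ⟨?_⟩
  simp only [mixture, Measure.add_apply, Measure.smul_apply, measure_univ, smul_eq_mul, mul_one]
  rw [← ENNReal.ofReal_add h0.le (by linarith)]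
  simp

theorem integrable_mixture (hD : Admissible ℓ Θ rf Dr Df) (θ : E d) :
    Integrable (ℓ θ) (mixture rf Dr Df) :=
  ((hD.integrable_forget θ).smul_measure ENNReal.ofReal_ne_top).add_measure
    ((hD.integrable_retain θ).smul_measure ENNReal.ofReal_ne_top)

/-- Stationarity of the trained model: the mean retain gradient balances the forget gradient. -/
theorem meanGrad_trained (hℓ : IsRegularLoss ℓ Θ μ β L) (hD : Admissible ℓ Θ rf Dr Df)
    (h0 : 0 < rf) (h1 : rf < 1) :
    meanGrad ℓ Dr (trained ℓ rf Dr Df) =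
      -((rf / (1 - rf)) • meanGrad ℓ Df (trained ℓ rf Dr Df)) := by
  have := hD.isProbabilityMeasure_mixture h0 h1
  set θs := trained ℓ rf Dr Df with hθ
  have h2 : meanGrad ℓ (mixture rf Dr Df) θs = 0 := hℓ.meanGrad_argMin hD.integrable_mixture
  have ir := hℓ.integrable_lossGrad hD.integrable_retain θs
  have if' := hℓ.integrable_lossGrad hD.integrable_forget θs
  rw [meanGrad, mixture, integral_add_measure (if'.smul_measure ENNReal.ofReal_ne_top)
    (ir.smul_measure ENNReal.ofReal_ne_top), integral_smul_measure, integral_smul_measure,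
    ENNReal.toReal_ofReal h0.le, ENNReal.toReal_ofReal (by linarith)] at h2
  change rf • meanGrad ℓ Df θs + (1 - rf) • meanGrad ℓ Dr θs = 0 at h2
  have h3 : (1 - rf) ≠ 0 := by linarith
  have h4 : meanGrad ℓ Dr θs = (1 - rf)⁻¹ • ((1 - rf) • meanGrad ℓ Dr θs) := by
    rw [smul_smul, inv_mul_cancel₀ h3, one_smul]
  rw [h4, eq_neg_of_add_eq_zero_right h2, smul_neg, smul_smul]
  congr 2
  field_simp

/-- The minimizer of the retain risk lies in the ball onto which the iterates are projected. -/
theorem norm_trained_sub_argMin_le (hℓ : IsRegularLoss ℓ Θ μ β L) (hD : Admissible ℓ Θ rf Dr Df)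
    (h0 : 0 < rf) (h1 : rf < 1) :
    ‖trained ℓ rf Dr Df - argMin (risk ℓ Dr)‖ ≤ rf / (1 - rf) * (L / μ) := by
  have := hD.prob_retain
  have := hD.prob_forget
  have hρ : 0 < rf / (1 - rf) := div_pos h0 (by linarith)
  have hL := hℓ.lip_pos
  have hμ := hℓ.mu_pos
  set θs := trained ℓ rf Dr Df with hθ
  set θr := argMin (risk ℓ Dr)
  have h2 := hℓ.mul_norm_sq_le_inner_meanGrad hD.integrable_retain θs θr
  rw [hℓ.meanGrad_argMin hD.integrable_retain, sub_zero] at h2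
  have h3 : ‖meanGrad ℓ Dr θs‖ ≤ rf / (1 - rf) * L := by
    rw [hD.meanGrad_trained hℓ h0 h1, norm_neg, norm_smul, Real.norm_of_nonneg hρ.le]
    gcongr
    have := norm_integral_le_of_norm_le_const (μ := Df)
      (ae_of_all _ fun ξ => hℓ.norm_lossGrad_le hD.trained_mem ξ)
    simpa [meanGrad] using this
  have h4 : μ * ‖θs - θr‖ ^ 2 ≤ rf / (1 - rf) * L * ‖θs - θr‖ :=
    h2.trans ((real_inner_le_norm _ _).trans (by gcongr))
  rcases (norm_nonneg (θs - θr)).eq_or_lt with h5 | h5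
  · rw [← h5]; positivity
  · have h6 : μ * ‖θs - θr‖ ≤ rf / (1 - rf) * L := by
      refine le_of_mul_le_mul_right ?_ h5
      linarith [h4, sq ‖θs - θr‖, mul_assoc μ ‖θs - θr‖ ‖θs - θr‖,
        congrArg (μ * ·) (sq ‖θs - θr‖)]
    rw [← mul_div_assoc, le_div_iff₀ hμ]
    linarith

end Admissible

/-! ### Exponential moments of the iterates -/

theorem norm_ballProj_sub_le {d : ℕ} {c y : E d} {R : ℝ} (hy : ‖y - c‖ ≤ R) (x : E d) :
    ‖ballProj c R x - y‖ ≤ ‖x - y‖ := by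
  unfold ballProj
  split_ifs with h
  · exact le_rfl
  push Not at h
  have hR : 0 ≤ R := (norm_nonneg _).trans hy
  have hpos : 0 < ‖x - c‖ := lt_of_le_of_lt hR h
  set p := c + (R / ‖x - c‖) • (x - c) with hp
  have e1 : x - p = (1 - R / ‖x - c‖) • (x - c) := by
    rw [hp, sub_smul, one_smul]; abel
  have e2 : p - y = (R / ‖x - c‖) • (x - c) - (y - c) := by
    rw [hp]; abel
  have h1 : 0 ≤ 1 - R / ‖x - c‖ := sub_nonneg.2 ((div_le_one hpos).2 h.le)
  -- The angle at the projection is obtuse.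
  have h2 : 0 ≤ ⟪x - p, p - y⟫ := by
    rw [e1, e2, real_inner_smul_left, inner_sub_right, real_inner_smul_right,
      real_inner_self_eq_norm_sq]
    refine mul_nonneg h1 ?_
    have h3 : R / ‖x - c‖ * ‖x - c‖ ^ 2 = ‖x - c‖ * R := by field_simp
    have h4 : ⟪x - c, y - c⟫ ≤ ‖x - c‖ * R :=
      (real_inner_le_norm _ _).trans (by gcongr)
    linarith
  have h5 : ‖x - y‖ ^ 2 = ‖x - p‖ ^ 2 + 2 * ⟪x - p, p - y⟫ + ‖p - y‖ ^ 2 := by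
    rw [← norm_add_sq_real, sub_add_sub_cancel]
  refine le_of_sq_le_sq ?_ (norm_nonneg _)
  nlinarith [sq_nonneg ‖x - p‖]

theorem measurable_ballProj {d : ℕ} (c : E d) (R : ℝ) : Measurable (ballProj c R) := by
  unfold ballProj
  exact Measurable.ite (measurableSet_le (by fun_prop) (by fun_prop)) (by fun_prop) (by fun_prop)

/-- The bound `r_f / (1 - r_f) L (1 + β / μ)` on the stochastic gradients in the ball. -/
noncomputable def gradBound (μ β L rf : ℝ) : ℝ := rf / (1 - rf) * L * (1 + β / μ)

/-- The squared distance to the minimizer of the retain risk, in units of `G² / μ²` where `G` is the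
bound on the stochastic gradients. -/
noncomputable def potential {d s : ℕ} (ℓ : E d → E s → ℝ) (μ β L rf : ℝ) (Dr : Measure (E s))
    (θ : E d) : ℝ :=
  (μ / gradBound μ β L rf) ^ 2 * ‖θ - argMin (risk ℓ Dr)‖ ^ 2

variable {d s : ℕ} {ℓ : E d → E s → ℝ} {Θ : Set (E d)} {μ β L rf : ℝ} {Dr Df : Measure (E s)}

theorem potential_nonneg (θ : E d) : 0 ≤ potential ℓ μ β L rf Dr θ := by
  unfold potential; positivity

theorem measurable_potential : Measurable (potential ℓ μ β L rf Dr) := by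
  unfold potential; fun_prop

theorem IsRegularLoss.gradBound_pos (hℓ : IsRegularLoss ℓ Θ μ β L) (h0 : 0 < rf) (h1 : rf < 1) :
    0 < gradBound μ β L rf := by
  have := hℓ.mu_pos
  have := hℓ.beta_pos
  have := hℓ.lip_pos
  have : 0 < 1 - rf := by linarith
  unfold gradBound
  positivity

theorem vrGrad_eq (θs θ : E d) (ξr ξf : E s) :
    vrGrad ℓ rf θs θ ξr ξf =
      lossGrad ℓ θ ξr - lossGrad ℓ θs ξr - (rf / (1 - rf)) • lossGrad ℓ θs ξf := rfl

theorem IsRegularLoss.measurable_vrGrad (hℓ : IsRegularLoss ℓ Θ μ β L) (θs : E d) :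
    Measurable fun p : E d × E s × E s => vrGrad ℓ rf θs p.1 p.2.1 p.2.2 := by
  simp_rw [vrGrad_eq]
  have h := hℓ.measurable_uncurry_lossGrad
  have hs := hℓ.measurable_lossGrad θs
  have h2 : Measurable fun p : E d × E s × E s => lossGrad ℓ θs p.2.1 :=
    hs.comp (by fun_prop : Measurable fun p : E d × E s × E s => p.2.1)
  have h3 : Measurable fun p : E d × E s × E s => lossGrad ℓ θs p.2.2 :=
    hs.comp (by fun_prop : Measurable fun p : E d × E s × E s => p.2.2)
  exact ((h.comp (by fun_prop : Measurable fun p : E d × E s × E s => (p.1, p.2.1))).sub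
    h2).sub (h3.fun_const_smul _)

theorem IsRegularLoss.measurable_step (hℓ : IsRegularLoss ℓ Θ μ β L) (θs : E d) (t : ℕ) :
    Measurable fun p : E d × E s × E s => step ℓ μ L rf θs t p.1 p.2.1 p.2.2 :=
  (measurable_ballProj _ _).comp (measurable_fst.sub ((hℓ.measurable_vrGrad θs).fun_const_smul _))

theorem isProbabilityMeasure_iterLaw [IsProbabilityMeasure Dr] [IsProbabilityMeasure Df]
    (hℓ : IsRegularLoss ℓ Θ μ β L) (θs : E d) (t : ℕ) :
    IsProbabilityMeasure (iterLaw ℓ μ L rf θs Dr Df t) := by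
  induction t with
  | zero => exact Measure.dirac.isProbabilityMeasure
  | succ t ih =>
    exact Measure.isProbabilityMeasure_map (hℓ.measurable_step θs (t + 1)).aemeasurable

theorem ae_iterLaw_mem_ball [IsProbabilityMeasure Dr] [IsProbabilityMeasure Df]
    (hℓ : IsRegularLoss ℓ Θ μ β L) (h0 : 0 < rf) (h1 : rf < 1) (θs : E d) (t : ℕ) :
    ∀ᵐ θ ∂(iterLaw ℓ μ L rf θs Dr Df t), ‖θ - θs‖ ≤ rf / (1 - rf) * (L / μ) := by
  have hR : 0 ≤ rf / (1 - rf) * (L / μ) := by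
    have := hℓ.mu_pos
    have := hℓ.lip_pos
    have : 0 < 1 - rf := by linarith
    positivity
  cases t with
  | zero => simp [iterLaw, ae_dirac_eq, hR]
  | succ t =>
    rw [iterLaw, ae_map_iff (hℓ.measurable_step θs (t + 1)).aemeasurable
      (measurableSet_le (by fun_prop) (by fun_prop))]
    refine ae_of_all _ fun p => ?_
    have := (ballProj_spec θs hR
      (p.1 - (1 / (μ * (t + 1 : ℕ))) • vrGrad ℓ rf θs p.1 p.2.1 p.2.2)).1
    rwa [Metric.mem_closedBall, dist_eq_norm] at this

theorem IsRegularLoss.norm_vrGrad_le (hℓ : IsRegularLoss ℓ Θ μ β L) (h0 : 0 < rf) (h1 : rf < 1)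
    {θs θ : E d} (hs : θs ∈ interior Θ) (hθ : ‖θ - θs‖ ≤ rf / (1 - rf) * (L / μ)) (ξr ξf : E s) :
    ‖vrGrad ℓ rf θs θ ξr ξf‖ ≤ gradBound μ β L rf := by
  have hρ : 0 < rf / (1 - rf) := div_pos h0 (by linarith)
  have hβ := hℓ.beta_pos
  rw [vrGrad_eq]
  calc _ ≤ ‖lossGrad ℓ θ ξr - lossGrad ℓ θs ξr‖ + ‖(rf / (1 - rf)) • lossGrad ℓ θs ξf‖ :=
        norm_sub_le _ _
    _ ≤ β * (rf / (1 - rf) * (L / μ)) + rf / (1 - rf) * L := by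
        rw [norm_smul, Real.norm_of_nonneg hρ.le]
        gcongr
        · exact (hℓ.lossGrad_lipschitz ξr θ θs).trans (by gcongr)
        · exact hℓ.norm_lossGrad_le hs ξf
    _ = gradBound μ β L rf := by unfold gradBound; ring

/-- The stochastic gradient is unbiased for the retain risk, by stationarity of the trained
model. -/
theorem Admissible.integral_vrGrad (hℓ : IsRegularLoss ℓ Θ μ β L) (hD : Admissible ℓ Θ rf Dr Df)
    (h0 : 0 < rf) (h1 : rf < 1) (θ : E d) :
    ∫ q : E s × E s, vrGrad ℓ rf (trained ℓ rf Dr Df) θ q.1 q.2 ∂(Dr.prod Df) =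
      meanGrad ℓ Dr θ := by
  have := hD.prob_retain
  have := hD.prob_forget
  set θs := trained ℓ rf Dr Df with hθs
  have i1 := hℓ.integrable_lossGrad hD.integrable_retain θ
  have i2 := hℓ.integrable_lossGrad hD.integrable_retain θs
  have i3 := hℓ.integrable_lossGrad hD.integrable_forget θs
  simp_rw [vrGrad_eq]
  have j1 : Integrable (fun q : E s × E s => lossGrad ℓ θ q.1) (Dr.prod Df) := i1.comp_fst Df
  have j2 : Integrable (fun q : E s × E s => lossGrad ℓ θs q.1) (Dr.prod Df) := i2.comp_fst Df
  have j3 : Integrable (fun q : E s × E s => lossGrad ℓ θs q.2) (Dr.prod Df) := i3.comp_snd Dr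
  have j12 : Integrable (fun q : E s × E s => lossGrad ℓ θ q.1 - lossGrad ℓ θs q.1)
    (Dr.prod Df) := j1.sub j2
  have j4 : Integrable (fun q : E s × E s => (rf / (1 - rf)) • lossGrad ℓ θs q.2)
    (Dr.prod Df) := j3.fun_smul _
  rw [integral_sub j12 j4, integral_sub j1 j2, integral_smul,
    integral_fun_fst (fun x => lossGrad ℓ θ x), integral_fun_fst (fun x => lossGrad ℓ θs x),
    integral_fun_snd (fun x => lossGrad ℓ θs x)]
  have h2 := hD.meanGrad_trained hℓ h0 h1
  rw [← hθs] at h2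
  simp only [probReal_univ, one_smul]
  change meanGrad ℓ Dr θ - meanGrad ℓ Dr θs - (rf / (1 - rf)) • meanGrad ℓ Df θs = meanGrad ℓ Dr θ
  rw [h2]
  abel

/-- Hoeffding's lemma as a bound on the exponential moments of a bounded variable. -/
theorem lintegral_exp_mul_le_of_abs_le {α : Type*} [MeasurableSpace α] {P : Measure α}
    [IsProbabilityMeasure P] {X : α → ℝ} (hX : Measurable X) {B : ℝ} (hB : ∀ q, |X q| ≤ B)
    (a : ℝ) :
    ∫⁻ q, ENNReal.ofReal (Real.exp (a * X q)) ∂P ≤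
      ENNReal.ofReal (Real.exp (a * ∫ q, X q ∂P + a ^ 2 * B ^ 2 / 2)) := by
  have hsub := hasSubgaussianMGF_of_mem_Icc (μ := P) (a := -B) (b := B) hX.aemeasurable
    (ae_of_all _ fun q => abs_le.1 (hB q))
  have hmgf := hsub.mgf_le a
  have hint := hsub.integrable_exp_mul a
  have hc : (((‖B - -B‖₊ / 2) ^ 2 : NNReal) : ℝ) = B ^ 2 := by
    push_cast
    rw [div_pow, Real.norm_eq_abs, sq_abs]
    ring
  rw [hc] at hmgf
  set m := ∫ q, X q ∂P
  have hsplit : ∀ q, Real.exp (a * X q) = Real.exp (a * m) * Real.exp (a * (X q - m)) := by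
    intro q
    rw [← Real.exp_add]; congr 1; ring
  have hi : Integrable (fun q => Real.exp (a * X q)) P := by
    simp_rw [hsplit]; exact hint.const_mul _
  rw [← ofReal_integral_eq_lintegral_ofReal hi (ae_of_all _ fun q => (Real.exp_pos _).le)]
  refine ENNReal.ofReal_le_ofReal ?_
  simp_rw [hsplit]
  rw [integral_const_mul, Real.exp_add]
  refine mul_le_mul_of_nonneg_left ?_ (Real.exp_pos _).le
  rw [mul_comm (a ^ 2)]
  exact hmgf

theorem Admissible.lintegral_exp_inner_vrGrad_le (hℓ : IsRegularLoss ℓ Θ μ β L)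
    (hD : Admissible ℓ Θ rf Dr Df) (h0 : 0 < rf) (h1 : rf < 1) {θ : E d}
    (hθ : ‖θ - trained ℓ rf Dr Df‖ ≤ rf / (1 - rf) * (L / μ)) (v : E d) (a : ℝ) :
    ∫⁻ q : E s × E s, ENNReal.ofReal (Real.exp (a *
        ⟪vrGrad ℓ rf (trained ℓ rf Dr Df) θ q.1 q.2, v⟫)) ∂(Dr.prod Df) ≤
      ENNReal.ofReal (Real.exp (a * ⟪meanGrad ℓ Dr θ, v⟫ +
        a ^ 2 * (gradBound μ β L rf * ‖v‖) ^ 2 / 2)) := by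
  have := hD.prob_retain
  have := hD.prob_forget
  have hgm : Measurable fun q : E s × E s => vrGrad ℓ rf (trained ℓ rf Dr Df) θ q.1 q.2 := by
    have h2 := hℓ.measurable_lossGrad (trained ℓ rf Dr Df)
    simp_rw [vrGrad_eq]
    exact (((hℓ.measurable_lossGrad θ).comp measurable_fst).sub (h2.comp measurable_fst)).sub
      ((h2.comp measurable_snd).fun_const_smul _)
  have hb : ∀ q : E s × E s, ‖vrGrad ℓ rf (trained ℓ rf Dr Df) θ q.1 q.2‖ ≤ gradBound μ β L rf :=
    fun q => hℓ.norm_vrGrad_le h0 h1 hD.trained_mem hθ q.1 q.2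
  have hgi : Integrable (fun q : E s × E s => vrGrad ℓ rf (trained ℓ rf Dr Df) θ q.1 q.2)
      (Dr.prod Df) := Integrable.of_bound hgm.aestronglyMeasurable _ (ae_of_all _ hb)
  have hmean : ∫ q : E s × E s, ⟪vrGrad ℓ rf (trained ℓ rf Dr Df) θ q.1 q.2, v⟫ ∂(Dr.prod Df) =
      ⟪meanGrad ℓ Dr θ, v⟫ := by
    rw [← hD.integral_vrGrad hℓ h0 h1 θ, real_inner_comm, ← integral_inner hgi]
    exact integral_congr_ae (ae_of_all _ fun q => real_inner_comm _ _)
  rw [← hmean]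
  refine lintegral_exp_mul_le_of_abs_le hgm.inner_const (fun q => ?_) a
  exact (abs_real_inner_le_norm _ _).trans (mul_le_mul_of_nonneg_right (hb q) (norm_nonneg v))

theorem Admissible.norm_step_sub_sq_le (hℓ : IsRegularLoss ℓ Θ μ β L)
    (hD : Admissible ℓ Θ rf Dr Df) (h0 : 0 < rf) (h1 : rf < 1) {θ : E d}
    (hθ : ‖θ - trained ℓ rf Dr Df‖ ≤ rf / (1 - rf) * (L / μ)) {t : ℕ} (ht : 1 ≤ t) (ξr ξf : E s) :
    ‖step ℓ μ L rf (trained ℓ rf Dr Df) t θ ξr ξf - argMin (risk ℓ Dr)‖ ^ 2 ≤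
      ‖θ - argMin (risk ℓ Dr)‖ ^ 2 -
        2 / (μ * t) * ⟪vrGrad ℓ rf (trained ℓ rf Dr Df) θ ξr ξf, θ - argMin (risk ℓ Dr)⟫ +
        gradBound μ β L rf ^ 2 / (μ * t) ^ 2 := by
  set θs := trained ℓ rf Dr Df
  set θr := argMin (risk ℓ Dr)
  set g := vrGrad ℓ rf θs θ ξr ξf with hg
  have hμ := hℓ.mu_pos
  have ht' : (0 : ℝ) < t := by exact_mod_cast ht
  have h2 : ‖step ℓ μ L rf θs t θ ξr ξf - θr‖ ≤ ‖θ - (1 / (μ * t)) • g - θr‖ := by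
    refine norm_ballProj_sub_le ?_ _
    rw [norm_sub_rev]
    exact hD.norm_trained_sub_argMin_le hℓ h0 h1
  have h3 : ‖θ - (1 / (μ * t)) • g - θr‖ ^ 2 =
      ‖θ - θr‖ ^ 2 - 2 / (μ * t) * ⟪g, θ - θr⟫ + (1 / (μ * t)) ^ 2 * ‖g‖ ^ 2 := by
    rw [sub_right_comm, norm_sub_sq_real, real_inner_smul_right, norm_smul, mul_pow,
      Real.norm_of_nonneg (by positivity), real_inner_comm]
    ring
  have h4 : ‖g‖ ≤ gradBound μ β L rf := hℓ.norm_vrGrad_le h0 h1 hD.trained_mem hθ _ _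
  calc _ ≤ ‖θ - (1 / (μ * t)) • g - θr‖ ^ 2 := by gcongr
    _ ≤ ‖θ - θr‖ ^ 2 - 2 / (μ * t) * ⟪g, θ - θr⟫ +
          (1 / (μ * t)) ^ 2 * gradBound μ β L rf ^ 2 := by
        rw [h3]; gcongr
    _ = _ := by rw [one_div, inv_pow]; ring

/-- One step of the recursion for the exponential moments. The contraction `2 / t` of the potential
outweighs both the growth of the factor `t / 4` and the variance term of Hoeffding's lemma. -/
theorem Admissible.lintegral_exp_potential_step_le (hℓ : IsRegularLoss ℓ Θ μ β L)
    (hD : Admissible ℓ Θ rf Dr Df) (h0 : 0 < rf) (h1 : rf < 1) {θ : E d}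
    (hθ : ‖θ - trained ℓ rf Dr Df‖ ≤ rf / (1 - rf) * (L / μ)) {t : ℕ} (ht : 1 ≤ t) :
    ∫⁻ q : E s × E s, ENNReal.ofReal (Real.exp (t / 4 *
        potential ℓ μ β L rf Dr (step ℓ μ L rf (trained ℓ rf Dr Df) t θ q.1 q.2))) ∂(Dr.prod Df) ≤
      ENNReal.ofReal (Real.exp ((t - 3 / 2) / 4 * potential ℓ μ β L rf Dr θ + 1 / (4 * t))) := by
  set θs := trained ℓ rf Dr Df with hθs
  set v := θ - argMin (risk ℓ Dr) with hv
  set G := gradBound μ β L rf with hG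
  have hG0 : 0 < G := hℓ.gradBound_pos h0 h1
  have hμ := hℓ.mu_pos
  have ht' : (0 : ℝ) < t := by exact_mod_cast ht
  set a : ℝ := μ / (2 * G ^ 2) with ha
  have hY : potential ℓ μ β L rf Dr θ = (μ / G) ^ 2 * ‖v‖ ^ 2 := rfl
  set K : ℝ := t / 4 * ((μ / G) ^ 2 * ‖v‖ ^ 2) + 1 / (4 * t) with hK
  have hpt : ∀ q : E s × E s, t / 4 * potential ℓ μ β L rf Dr (step ℓ μ L rf θs t θ q.1 q.2) ≤
      K + -a * ⟪vrGrad ℓ rf θs θ q.1 q.2, v⟫ := by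
    intro q
    calc _ ≤ t / 4 * ((μ / G) ^ 2 * (‖v‖ ^ 2 -
            2 / (μ * t) * ⟪vrGrad ℓ rf θs θ q.1 q.2, v⟫ + G ^ 2 / (μ * t) ^ 2)) := by
          unfold potential
          gcongr
          exact hD.norm_step_sub_sq_le hℓ h0 h1 hθ ht q.1 q.2
      _ = _ := by
          rw [hK, ha]
          field_simp
          ring
  calc _ ≤ ∫⁻ q : E s × E s, ENNReal.ofReal (Real.exp K) *
          ENNReal.ofReal (Real.exp (-a * ⟪vrGrad ℓ rf θs θ q.1 q.2, v⟫)) ∂(Dr.prod Df) := by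
        refine lintegral_mono fun q => ?_
        rw [← ENNReal.ofReal_mul (Real.exp_pos _).le, ← Real.exp_add]
        exact ENNReal.ofReal_le_ofReal (Real.exp_le_exp.2 (hpt q))
    _ ≤ ENNReal.ofReal (Real.exp K) * ENNReal.ofReal (Real.exp (-(a * μ) * ‖v‖ ^ 2 +
          a ^ 2 * G ^ 2 * ‖v‖ ^ 2 / 2)) := by
        rw [lintegral_const_mul' _ _ ENNReal.ofReal_ne_top]
        gcongr
        refine (hD.lintegral_exp_inner_vrGrad_le hℓ h0 h1 hθ v (-a)).trans
          (ENNReal.ofReal_le_ofReal (Real.exp_le_exp.2 ?_))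
        have h2 : μ * ‖v‖ ^ 2 ≤ ⟪meanGrad ℓ Dr θ, v⟫ := by
          have := hD.prob_retain
          have h3 := hℓ.mul_norm_sq_le_inner_meanGrad hD.integrable_retain θ (argMin (risk ℓ Dr))
          rwa [hℓ.meanGrad_argMin hD.integrable_retain, sub_zero] at h3
        have h4 : 0 ≤ a := by positivity
        nlinarith
    _ = _ := by
        rw [← ENNReal.ofReal_mul (Real.exp_pos _).le, ← Real.exp_add]
        congr 2
        rw [hY, hK, ha]
        field_simp
        ring

/-- Convexity of `exp`, in a form that yields `𝔼 exp (p y) ≤ exp (p k)` from `𝔼 exp y ≤ exp k`. -/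
theorem exp_mul_le {p : ℝ} (h0 : 0 ≤ p) (h1 : p ≤ 1) (y k : ℝ) :
    Real.exp (p * y) ≤ Real.exp (p * k) * ((1 - p) + p * Real.exp (y - k)) := by
  have h := convexOn_exp.2 (Set.mem_univ 0) (Set.mem_univ (y - k)) (sub_nonneg.2 h1) h0 (by ring)
  simp only [smul_eq_mul, mul_zero, zero_add, Real.exp_zero, mul_one] at h
  calc Real.exp (p * y) = Real.exp (p * k) * Real.exp (p * (y - k)) := by
        rw [← Real.exp_add]; congr 1; ring
    _ ≤ _ := by gcongr

theorem lintegral_exp_mul_le {α : Type*} [MeasurableSpace α] {P : Measure α}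
    [IsProbabilityMeasure P] {f : α → ℝ} {p k : ℝ} (h0 : 0 ≤ p) (h1 : p ≤ 1)
    (h : ∫⁻ x, ENNReal.ofReal (Real.exp (f x)) ∂P ≤ ENNReal.ofReal (Real.exp k)) :
    ∫⁻ x, ENNReal.ofReal (Real.exp (p * f x)) ∂P ≤ ENNReal.ofReal (Real.exp (p * k)) := by
  calc _ ≤ ∫⁻ x, ENNReal.ofReal (Real.exp (p * k)) * (ENNReal.ofReal (1 - p) +
          ENNReal.ofReal (p * Real.exp (-k)) * ENNReal.ofReal (Real.exp (f x))) ∂P := by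
        refine lintegral_mono fun x => ?_
        rw [← ENNReal.ofReal_mul (by positivity), ← ENNReal.ofReal_add (sub_nonneg.2 h1)
          (by positivity), ← ENNReal.ofReal_mul (by positivity)]
        refine ENNReal.ofReal_le_ofReal ((exp_mul_le h0 h1 (f x) k).trans (le_of_eq ?_))
        rw [sub_eq_add_neg (f x), Real.exp_add]
        ring
    _ ≤ ENNReal.ofReal (Real.exp (p * k)) * (ENNReal.ofReal (1 - p) +
          ENNReal.ofReal (p * Real.exp (-k)) * ENNReal.ofReal (Real.exp k)) := by
        rw [lintegral_const_mul' _ _ ENNReal.ofReal_ne_top, lintegral_add_left measurable_const,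
          lintegral_const_mul' _ _ ENNReal.ofReal_ne_top, lintegral_const, measure_univ, mul_one]
        gcongr
    _ = ENNReal.ofReal (Real.exp (p * k)) := by
        rw [← ENNReal.ofReal_mul (by positivity), mul_assoc, ← Real.exp_add, neg_add_cancel,
          Real.exp_zero, mul_one, ← ENNReal.ofReal_add (sub_nonneg.2 h1) h0]
        simp

/-- The last iterate after `t ≥ 1` steps is at distance of order `G / (μ √t)` from the minimizer of
the retain risk, with a sub-exponential squared distance. -/
theorem Admissible.lintegral_exp_potential_le (hℓ : IsRegularLoss ℓ Θ μ β L)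
    (hD : Admissible ℓ Θ rf Dr Df) (h0 : 0 < rf) (h1 : rf < 1) {t : ℕ} (ht : 1 ≤ t) :
    ∫⁻ θ, ENNReal.ofReal (Real.exp (t / 4 * potential ℓ μ β L rf Dr θ))
        ∂(iterLaw ℓ μ L rf (trained ℓ rf Dr Df) Dr Df t) ≤ ENNReal.ofReal (Real.exp (1 / 2)) := by
  have := hD.prob_retain
  have := hD.prob_forget
  set θs := trained ℓ rf Dr Df with hθs
  have hP := fun n => isProbabilityMeasure_iterLaw (Dr := Dr) (Df := Df) (rf := rf) hℓ θs n
  have hrec : ∀ n : ℕ, ∫⁻ θ, ENNReal.ofReal (Real.exp ((n + 1 : ℕ) / 4 *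
        potential ℓ μ β L rf Dr θ)) ∂(iterLaw ℓ μ L rf θs Dr Df (n + 1)) ≤
      ∫⁻ θ, ENNReal.ofReal (Real.exp (((n + 1 : ℕ) - 3 / 2) / 4 * potential ℓ μ β L rf Dr θ +
        1 / (4 * (n + 1 : ℕ)))) ∂(iterLaw ℓ μ L rf θs Dr Df n) := by
    intro n
    have hm : Measurable fun θ : E d => ENNReal.ofReal (Real.exp ((n + 1 : ℕ) / 4 *
        potential ℓ μ β L rf Dr θ)) :=
      (Real.measurable_exp.comp (measurable_potential.const_mul _)).ennreal_ofReal
    have hstep := hℓ.measurable_step (rf := rf) θs (n + 1)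
    rw [iterLaw, lintegral_map hm hstep, lintegral_prod
      (μ := iterLaw ℓ μ L rf θs Dr Df n) (ν := Dr.prod Df)
      (fun p => ENNReal.ofReal (Real.exp ((n + 1 : ℕ) / 4 *
        potential ℓ μ β L rf Dr (step ℓ μ L rf θs (n + 1) p.1 p.2.1 p.2.2))))
      (hm.comp hstep).aemeasurable]
    refine lintegral_mono_ae ?_
    filter_upwards [ae_iterLaw_mem_ball (Dr := Dr) (Df := Df) hℓ h0 h1 θs n] with θ hθ
    exact hD.lintegral_exp_potential_step_le hℓ h0 h1 hθ (Nat.le_add_left 1 n)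
  induction t, ht using Nat.le_induction with
  | base =>
    -- For the first step the coefficient `1 - 3 / 2` is negative.
    refine (hrec 0).trans ?_
    calc _ ≤ ∫⁻ _, ENNReal.ofReal (Real.exp (1 / 2)) ∂(iterLaw ℓ μ L rf θs Dr Df 0) := by
          refine lintegral_mono fun θ => ENNReal.ofReal_le_ofReal (Real.exp_le_exp.2 ?_)
          have := potential_nonneg (ℓ := ℓ) (μ := μ) (β := β) (L := L) (rf := rf) (Dr := Dr) θ
          norm_num
          linarith
      _ = _ := by rw [lintegral_const, measure_univ, mul_one]
  | succ n hn ih =>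
    refine (hrec n).trans ?_
    have hn' : (1 : ℝ) ≤ n := by exact_mod_cast hn
    set p : ℝ := (n - 1 / 2) / n with hp
    have hp0 : 0 ≤ p := div_nonneg (by linarith) (by linarith)
    have hp1 : p ≤ 1 := (div_le_one (by linarith)).2 (by linarith)
    have h2 := lintegral_exp_mul_le hp0 hp1 ih
    calc _ = ∫⁻ θ, ENNReal.ofReal (Real.exp (1 / (4 * (n + 1 : ℕ)))) *
            ENNReal.ofReal (Real.exp (p * (n / 4 * potential ℓ μ β L rf Dr θ)))
            ∂(iterLaw ℓ μ L rf θs Dr Df n) := by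
          refine lintegral_congr fun θ => ?_
          rw [← ENNReal.ofReal_mul (Real.exp_pos _).le, ← Real.exp_add]
          congr 2
          rw [hp]
          push_cast
          field_simp
          ring
      _ ≤ ENNReal.ofReal (Real.exp (1 / (4 * (n + 1 : ℕ)))) *
            ENNReal.ofReal (Real.exp (p * (1 / 2))) := by
          rw [lintegral_const_mul' _ _ ENNReal.ofReal_ne_top]
          gcongr
      _ ≤ _ := by
          rw [← ENNReal.ofReal_mul (Real.exp_pos _).le, ← Real.exp_add]
          refine ENNReal.ofReal_le_ofReal (Real.exp_le_exp.2 ?_)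
          have h3 : p * (1 / 2) = 1 / 2 - 1 / (4 * n) := by rw [hp]; field_simp; ring
          have h4 : (1 : ℝ) / (4 * (n + 1 : ℕ)) ≤ 1 / (4 * n) := by
            push_cast
            gcongr
            linarith
          linarith

/-! ### Unlearning -/

/-- The term `624 log (2 / δ)` absorbs the negative value of `log log T` at `T = 2`. -/
theorem one_add_two_mul_log_le_h {T : ℕ} (hT : 2 ≤ T) {δ : ℝ} (hδ : 0 < δ) (hδ1 : δ < 1) :
    1 + 2 * Real.log (2 / δ) ≤ h T δ := by
  have hT' : (2 : ℝ) ≤ T := by exact_mod_cast hT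
  have h2 := Real.log_two_gt_d9
  have h1 : -(1 / 2) ≤ Real.log (Real.log T) := by
    rw [Real.le_log_iff_exp_le (Real.log_pos (by linarith))]
    have h3 := Real.add_one_le_exp (1 / 2 : ℝ)
    have h4 : Real.exp (-(1 / 2)) ≤ 2 / 3 := by
      rw [Real.exp_neg, inv_le_comm₀ (Real.exp_pos _) (by norm_num)]
      norm_num at h3 ⊢
      exact h3
    have h5 : Real.log 2 ≤ Real.log T := Real.log_le_log (by norm_num) hT'
    linarith
  have h3 : Real.log 2 ≤ Real.log (2 / δ) := by
    refine Real.log_le_log (by norm_num) ?_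
    rw [le_div_iff₀ hδ]; linarith
  unfold h
  linarith

theorem h_pos {T : ℕ} (hT : 2 ≤ T) {δ : ℝ} (hδ : 0 < δ) (hδ1 : δ < 1) : 0 < h T δ := by
  have h1 := one_add_two_mul_log_le_h hT hδ hδ1
  have h2 : 0 < Real.log (2 / δ) := Real.log_pos (by rw [lt_div_iff₀ hδ]; linarith)
  linarith

theorem IsRegularLoss.nu_pos (hℓ : IsRegularLoss ℓ Θ μ β L) {T : ℕ} (hT : 2 ≤ T) {δ : ℝ}
    (hδ : 0 < δ) (hδ1 : δ < 1) : 0 < nu μ β L δ T := by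
  have := hℓ.mu_pos
  have := hℓ.beta_pos
  have := hℓ.lip_pos
  have := h_pos hT hδ hδ1
  have : (0 : ℝ) < T := by exact_mod_cast (by omega : 0 < T)
  unfold nu
  positivity

theorem IsRegularLoss.sq_mul_nu (hℓ : IsRegularLoss ℓ Θ μ β L) {T : ℕ} (hT : 2 ≤ T) {δ : ℝ}
    (hδ : 0 < δ) (hδ1 : δ < 1) :
    (rf / (1 - rf) * nu μ β L δ T) ^ 2 = (gradBound μ β L rf / μ) ^ 2 * (2 * h T δ / T) := by
  have hμ := hℓ.mu_pos
  have hT' : (0 : ℝ) < T := by exact_mod_cast (by omega : 0 < T)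
  have h1 : √(2 * h T δ) ^ 2 = 2 * h T δ :=
    Real.sq_sqrt (mul_nonneg two_pos.le (h_pos hT hδ hδ1).le)
  have h2 : √(T : ℝ) ^ 2 = T := Real.sq_sqrt hT'.le
  have h3 : (rf / (1 - rf) * nu μ β L δ T) ^ 2 =
      (gradBound μ β L rf / μ) ^ 2 * (√(2 * h T δ) ^ 2 / √(T : ℝ) ^ 2) := by
    unfold nu gradBound
    have : √(T : ℝ) ≠ 0 := (Real.sqrt_pos.2 hT').ne'
    generalize rf / (1 - rf) = ρ
    generalize 1 + β / μ = κ
    field_simp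
  rw [h3, h1, h2]

theorem norm_sub_argMin_sq_eq (hℓ : IsRegularLoss ℓ Θ μ β L) (h0 : 0 < rf) (h1 : rf < 1)
    (θ : E d) :
    ‖θ - argMin (risk ℓ Dr)‖ ^ 2 =
      (gradBound μ β L rf / μ) ^ 2 * potential ℓ μ β L rf Dr θ := by
  have hμ := hℓ.mu_pos
  have hG := hℓ.gradBound_pos h0 h1
  unfold potential
  field_simp

/-- With probability at least `1 - δ / 2` the last iterate is within the distance from the retrained
model to which the noise is calibrated. -/
theorem Admissible.iterLaw_far_le (hℓ : IsRegularLoss ℓ Θ μ β L) (hD : Admissible ℓ Θ rf Dr Df)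
    (h0 : 0 < rf) (h1 : rf < 1) {T : ℕ} (hT : 2 ≤ T) {δ : ℝ} (hδ : 0 < δ) (hδ1 : δ < 1) :
    iterLaw ℓ μ L rf (trained ℓ rf Dr Df) Dr Df T
      {θ | ‖θ - argMin (risk ℓ Dr)‖ ≤ rf / (1 - rf) * nu μ β L δ T}ᶜ ≤ ENNReal.ofReal (δ / 2) := by
  have hT' : (0 : ℝ) < T := by exact_mod_cast (by omega : 0 < T)
  have hexp := hD.lintegral_exp_potential_le hℓ h0 h1 (by omega : 1 ≤ T)
  set P := iterLaw ℓ μ L rf (trained ℓ rf Dr Df) Dr Df T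
  have hsub : {θ : E d | ‖θ - argMin (risk ℓ Dr)‖ ≤ rf / (1 - rf) * nu μ β L δ T}ᶜ ⊆
      {θ | ENNReal.ofReal (Real.exp (h T δ / 2)) ≤
        ENNReal.ofReal (Real.exp (T / 4 * potential ℓ μ β L rf Dr θ))} := by
    intro θ hθ
    have h2 : rf / (1 - rf) * nu μ β L δ T < ‖θ - argMin (risk ℓ Dr)‖ := not_le.1 hθ
    have hρ : 0 < rf / (1 - rf) := div_pos h0 (by linarith)
    have h3 : (rf / (1 - rf) * nu μ β L δ T) ^ 2 < ‖θ - argMin (risk ℓ Dr)‖ ^ 2 :=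
      pow_lt_pow_left₀ h2 (mul_pos hρ (hℓ.nu_pos hT hδ hδ1)).le two_ne_zero
    rw [hℓ.sq_mul_nu hT hδ hδ1, norm_sub_argMin_sq_eq hℓ h0 h1] at h3
    have h4 := lt_of_mul_lt_mul_left h3 (sq_nonneg _)
    rw [div_lt_iff₀ hT'] at h4
    exact ENNReal.ofReal_le_ofReal (Real.exp_le_exp.2 (by linarith))
  refine (measure_mono hsub).trans ?_
  have hm : Measurable fun θ => ENNReal.ofReal (Real.exp (T / 4 * potential ℓ μ β L rf Dr θ)) :=
    (Real.measurable_exp.comp (measurable_potential.const_mul _)).ennreal_ofReal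
  have hmk := (mul_meas_ge_le_lintegral (μ := P) hm
    (ENNReal.ofReal (Real.exp (h T δ / 2)))).trans hexp
  rw [mul_comm, ← ENNReal.le_div_iff_mul_le (Or.inl (by simp [Real.exp_pos]))
    (Or.inl ENNReal.ofReal_ne_top), ← ENNReal.ofReal_div_of_pos (Real.exp_pos _),
    ← Real.exp_sub] at hmk
  refine hmk.trans (ENNReal.ofReal_le_ofReal ?_)
  calc Real.exp (1 / 2 - h T δ / 2) ≤ Real.exp (-Real.log (2 / δ)) := by
        have := one_add_two_mul_log_le_h hT hδ hδ1
        exact Real.exp_le_exp.2 (by linarith)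
    _ = δ / 2 := by rw [Real.exp_neg, Real.exp_log (by positivity), inv_div]

theorem vru_apply [IsProbabilityMeasure Dr] [IsProbabilityMeasure Df]
    (hℓ : IsRegularLoss ℓ Θ μ β L) (ε δ : ℝ) (T : ℕ) {S : Set (E d)} (hS : MeasurableSet S) :
    vru ℓ μ β L rf ε δ T Dr Df S =
      ∫⁻ θ, gaussianAt (rf / (1 - rf) * nu μ β L δ T * kdp ε δ) θ S
        ∂(iterLaw ℓ μ L rf (trained ℓ rf Dr Df) Dr Df T) := by
  have := isProbabilityMeasure_iterLaw (Dr := Dr) (Df := Df) (rf := rf) hℓ (trained ℓ rf Dr Df) T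
  rw [vru, Measure.map_apply (by fun_prop) hS, Measure.prod_apply ((by fun_prop :
    Measurable fun p : E d × E d => p.1 + (rf / (1 - rf) * nu μ β L δ T * kdp ε δ) • p.2) hS)]
  refine lintegral_congr fun θ => ?_
  rw [gaussianAt, Measure.map_apply (by fun_prop) hS]
  rfl

theorem isProbabilityMeasure_vru [IsProbabilityMeasure Dr] [IsProbabilityMeasure Df]
    (hℓ : IsRegularLoss ℓ Θ μ β L) (ε δ : ℝ) (T : ℕ) :
    IsProbabilityMeasure (vru ℓ μ β L rf ε δ T Dr Df) := by
  have := isProbabilityMeasure_iterLaw (Dr := Dr) (Df := Df) (rf := rf) hℓ (trained ℓ rf Dr Df) T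
  exact Measure.isProbabilityMeasure_map (by fun_prop)

/-- Indistinguishability of a fixed law and a mixture, most of whose components are individually
indistinguishable from it. -/
theorem lintegral_indistinguishable {α : Type*} [MeasurableSpace α] {P : Measure α}
    [IsProbabilityMeasure P] {f : α → ENNReal} {q c : ENNReal} {δ : ℝ} (hδ : 0 < δ)
    (hc : c ≠ ⊤) (hq : q ≤ 1) (hf : ∀ x, f x ≤ 1) {B : Set α} (hB : MeasurableSet B)
    (hPB : P Bᶜ ≤ ENNReal.ofReal (δ / 2))
    (h1 : ∀ x ∈ B, f x ≤ c * q + ENNReal.ofReal (δ / 2))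
    (h2 : ∀ x ∈ B, q ≤ c * f x + ENNReal.ofReal (δ / 2)) :
    ∫⁻ x, f x ∂P ≤ c * q + ENNReal.ofReal δ ∧ q ≤ c * ∫⁻ x, f x ∂P + ENNReal.ofReal δ := by
  have hδ2 : ENNReal.ofReal (δ / 2) + ENNReal.ofReal (δ / 2) = ENNReal.ofReal δ := by
    rw [← ENNReal.ofReal_add (by positivity) (by positivity), add_halves]
  have hind : ∫⁻ x, Bᶜ.indicator 1 x ∂P ≤ ENNReal.ofReal (δ / 2) := by
    rwa [lintegral_indicator_one hB.compl]
  have him : Measurable (Bᶜ.indicator (1 : α → ENNReal)) := measurable_one.indicator hB.compl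
  constructor
  · calc ∫⁻ x, f x ∂P ≤ ∫⁻ x, (c * q + ENNReal.ofReal (δ / 2)) + Bᶜ.indicator 1 x ∂P := by
          refine lintegral_mono fun x => ?_
          by_cases hx : x ∈ B
          · exact (h1 x hx).trans le_self_add
          · rw [Set.indicator_of_mem (by exact hx)]
            exact (hf x).trans le_add_self
      _ ≤ c * q + ENNReal.ofReal (δ / 2) + ENNReal.ofReal (δ / 2) := by
          rw [lintegral_add_right _ him, lintegral_const, measure_univ, mul_one]
          gcongr
      _ = _ := by rw [add_assoc, hδ2]
  · calc q = ∫⁻ _, q ∂P := by rw [lintegral_const, measure_univ, mul_one]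
      _ ≤ ∫⁻ x, (c * f x + ENNReal.ofReal (δ / 2)) + Bᶜ.indicator 1 x ∂P := by
          refine lintegral_mono fun x => ?_
          by_cases hx : x ∈ B
          · exact (h2 x hx).trans le_self_add
          · rw [Set.indicator_of_mem (by exact hx)]
            exact hq.trans le_add_self
      _ ≤ c * ∫⁻ x, f x ∂P + ENNReal.ofReal (δ / 2) + ENNReal.ofReal (δ / 2) := by
          rw [lintegral_add_right _ him, lintegral_add_right _ measurable_const,
            lintegral_const_mul' _ _ hc, lintegral_const, measure_univ, mul_one]
          gcongr
      _ = _ := by rw [add_assoc, hδ2]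

/-- Unlearning: the retraining algorithm adds the same noise to the minimizer of the retain risk. -/
theorem isUnlearning_vru (hℓ : IsRegularLoss ℓ Θ μ β L) (h0 : 0 < rf) (h1 : rf < 1) {ε δ : ℝ}
    (hε : 0 < ε) (hε1 : ε ≤ 1) (hδ : 0 < δ) (hδ1 : δ < 1) {T : ℕ} (hT : 2 ≤ T) :
    IsUnlearning (Admissible ℓ Θ rf) (vru ℓ μ β L rf ε δ T) ε δ := by
  refine ⟨fun Dr => gaussianAt (rf / (1 - rf) * nu μ β L δ T * kdp ε δ) (argMin (risk ℓ Dr)),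
    fun _ => inferInstance, fun Dr Df hD => ?_⟩
  have := hD.prob_retain
  have := hD.prob_forget
  refine ⟨isProbabilityMeasure_vru hℓ ε δ T, fun S hS => ?_⟩
  have := isProbabilityMeasure_iterLaw (Dr := Dr) (Df := Df) (rf := rf) hℓ (trained ℓ rf Dr Df) T
  have hΔ : 0 < rf / (1 - rf) * nu μ β L δ T :=
    mul_pos (div_pos h0 (by linarith)) (hℓ.nu_pos hT hδ hδ1)
  rw [vru_apply hℓ ε δ T hS]
  refine lintegral_indistinguishable hδ ENNReal.ofReal_ne_top prob_le_one (fun _ => prob_le_one)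
    (measurableSet_le (by fun_prop) (by fun_prop)) (hD.iterLaw_far_le hℓ h0 h1 hT hδ hδ1)
    (fun θ hθ => gaussianAt_le hε hε1 hδ hδ1 hΔ hθ hS)
    (fun θ hθ => gaussianAt_le hε hε1 hδ hδ1 hΔ ?_ hS)
  rw [norm_sub_rev]
  exact hθ

/-! ### Convergence -/

theorem Admissible.integral_potential_le (hℓ : IsRegularLoss ℓ Θ μ β L)
    (hD : Admissible ℓ Θ rf Dr Df) (h0 : 0 < rf) (h1 : rf < 1) {T : ℕ} (hT : 1 ≤ T) :
    Integrable (potential ℓ μ β L rf Dr) (iterLaw ℓ μ L rf (trained ℓ rf Dr Df) Dr Df T) ∧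
      ∫ θ, potential ℓ μ β L rf Dr θ ∂(iterLaw ℓ μ L rf (trained ℓ rf Dr Df) Dr Df T) ≤ 8 / T := by
  have hT' : (0 : ℝ) < T := by exact_mod_cast hT
  have hexp := hD.lintegral_exp_potential_le hℓ h0 h1 hT
  set P := iterLaw ℓ μ L rf (trained ℓ rf Dr Df) Dr Df T
  have hm : Measurable (potential ℓ μ β L rf Dr) := measurable_potential
  have hle : ∫⁻ θ, ENNReal.ofReal (potential ℓ μ β L rf Dr θ) ∂P ≤ ENNReal.ofReal (8 / T) := by
    calc _ ≤ ∫⁻ θ, ENNReal.ofReal (4 / T) *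
            ENNReal.ofReal (Real.exp (T / 4 * potential ℓ μ β L rf Dr θ)) ∂P := by
          refine lintegral_mono fun θ => ?_
          rw [← ENNReal.ofReal_mul (by positivity)]
          refine ENNReal.ofReal_le_ofReal ?_
          calc potential ℓ μ β L rf Dr θ = 4 / T * (T / 4 * potential ℓ μ β L rf Dr θ) := by
                field_simp
            _ ≤ _ := by
                gcongr
                linarith [Real.add_one_le_exp (T / 4 * potential ℓ μ β L rf Dr θ)]
      _ ≤ ENNReal.ofReal (4 / T) * ENNReal.ofReal (Real.exp (1 / 2)) := by
          rw [lintegral_const_mul' _ _ ENNReal.ofReal_ne_top]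
          gcongr
      _ ≤ ENNReal.ofReal (8 / T) := by
          rw [← ENNReal.ofReal_mul (by positivity)]
          refine ENNReal.ofReal_le_ofReal ?_
          calc 4 / (T : ℝ) * Real.exp (1 / 2) ≤ 4 / T * 2 := by gcongr; exact exp_half_le_two
            _ = 8 / T := by ring
  have h0' : 0 ≤ᵐ[P] potential ℓ μ β L rf Dr := ae_of_all _ fun θ => potential_nonneg θ
  refine ⟨⟨hm.aestronglyMeasurable, ?_⟩, ?_⟩
  · rw [hasFiniteIntegral_iff_ofReal h0']
    exact hle.trans_lt ENNReal.ofReal_lt_top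
  · rw [integral_eq_lintegral_of_nonneg_ae h0' hm.aestronglyMeasurable]
    exact ENNReal.toReal_le_of_le_ofReal (by positivity) hle

/-- The expected excess risk of the output. -/
theorem Admissible.integral_excess_le (hℓ : IsRegularLoss ℓ Θ μ β L)
    (hD : Admissible ℓ Θ rf Dr Df) (h0 : 0 < rf) (h1 : rf < 1) {ε δ : ℝ} (hδ : 0 < δ)
    (hδ1 : δ < 1) {T : ℕ} (hT : 2 ≤ T) :
    Integrable (fun θ => risk ℓ Dr θ - risk ℓ Dr (argMin (risk ℓ Dr)))
        (vru ℓ μ β L rf ε δ T Dr Df) ∧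
      ∫ θ, (risk ℓ Dr θ - risk ℓ Dr (argMin (risk ℓ Dr))) ∂(vru ℓ μ β L rf ε δ T Dr Df) ≤
        2 * β * (gradBound μ β L rf / μ) ^ 2 * (8 + 2 * h T δ * (d * kdp ε δ ^ 2)) / T := by
  have := hD.prob_retain
  have := hD.prob_forget
  have := isProbabilityMeasure_iterLaw (Dr := Dr) (Df := Df) (rf := rf) hℓ (trained ℓ rf Dr Df) T
  obtain ⟨hYi, hY⟩ := hD.integral_potential_le hℓ h0 h1 (by omega : 1 ≤ T)
  set P := iterLaw ℓ μ L rf (trained ℓ rf Dr Df) Dr Df T with hP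
  have hβ := hℓ.beta_pos
  set σ := rf / (1 - rf) * nu μ β L δ T * kdp ε δ with hσ
  set b := (gradBound μ β L rf / μ) ^ 2 with hb
  have hb0 : 0 ≤ b := sq_nonneg _
  set f : E d → ℝ := fun θ => risk ℓ Dr θ - risk ℓ Dr (argMin (risk ℓ Dr)) with hf
  have hfc : Continuous f := (hℓ.continuous_risk hD.integrable_retain).sub continuous_const
  have hf0 : ∀ θ, 0 ≤ f θ := fun θ =>
    sub_nonneg.2 (hℓ.isMinOn_argMin hD.integrable_retain (Set.mem_univ θ))
  have hφ : Measurable fun p : E d × E d => p.1 + σ • p.2 := by fun_prop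
  set g : E d × E d → ℝ := fun p =>
    2 * β * b * potential ℓ μ β L rf Dr p.1 + 2 * β * σ ^ 2 * ‖p.2‖ ^ 2 with hg
  have hfg : ∀ p : E d × E d, f (p.1 + σ • p.2) ≤ g p := by
    intro p
    have h2 : f (p.1 + σ • p.2) ≤ β * ‖p.1 + σ • p.2 - argMin (risk ℓ Dr)‖ ^ 2 :=
      hℓ.excess_le hD.integrable_retain _
    have h3 : ‖p.1 + σ • p.2 - argMin (risk ℓ Dr)‖ ≤
        ‖p.1 - argMin (risk ℓ Dr)‖ + |σ| * ‖p.2‖ := by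
      rw [add_sub_right_comm, ← Real.norm_eq_abs, ← norm_smul]
      exact norm_add_le _ _
    have h4 : ‖p.1 + σ • p.2 - argMin (risk ℓ Dr)‖ ^ 2 ≤
        2 * (b * potential ℓ μ β L rf Dr p.1) + 2 * (σ ^ 2 * ‖p.2‖ ^ 2) := by
      rw [hb, ← norm_sub_argMin_sq_eq hℓ h0 h1, ← sq_abs σ, ← mul_pow]
      calc _ ≤ (‖p.1 - argMin (risk ℓ Dr)‖ + |σ| * ‖p.2‖) ^ 2 := by gcongr
        _ ≤ _ := by rw [← mul_add]; exact add_sq_le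
    calc _ ≤ _ := h2
      _ ≤ β * (2 * (b * potential ℓ μ β L rf Dr p.1) + 2 * (σ ^ 2 * ‖p.2‖ ^ 2)) := by gcongr
      _ = g p := by rw [hg]; ring
  have hg1 : Integrable (fun p : E d × E d => 2 * β * b * potential ℓ μ β L rf Dr p.1)
      (P.prod (stdGaussian (E d))) := (hYi.const_mul _).comp_fst _
  have hg2 : Integrable (fun p : E d × E d => 2 * β * σ ^ 2 * ‖p.2‖ ^ 2)
      (P.prod (stdGaussian (E d))) := (integrable_norm_sq_stdGaussian.const_mul _).comp_snd P
  have hfi : Integrable (fun p : E d × E d => f (p.1 + σ • p.2)) (P.prod (stdGaussian (E d))) :=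
    (hg1.add hg2).mono' (hfc.measurable.comp hφ).aestronglyMeasurable
      (ae_of_all _ fun p => by rw [Real.norm_of_nonneg (hf0 _)]; exact hfg p)
  have hvru : vru ℓ μ β L rf ε δ T Dr Df =
      (P.prod (stdGaussian (E d))).map fun p => p.1 + σ • p.2 := rfl
  rw [hvru, integrable_map_measure hfc.aestronglyMeasurable hφ.aemeasurable,
    integral_map hφ.aemeasurable hfc.aestronglyMeasurable]
  refine ⟨hfi, ?_⟩
  calc _ ≤ ∫ p, g p ∂(P.prod (stdGaussian (E d))) := integral_mono hfi (hg1.add hg2) hfg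
    _ = 2 * β * b * ∫ θ, potential ℓ μ β L rf Dr θ ∂P + 2 * β * σ ^ 2 * d := by
        rw [hg, integral_add hg1 hg2,
          integral_fun_fst (fun x => 2 * β * b * potential ℓ μ β L rf Dr x),
          integral_fun_snd (fun x : E d => 2 * β * σ ^ 2 * ‖x‖ ^ 2), integral_const_mul,
          integral_const_mul, integral_norm_sq_stdGaussian]
        simp
    _ ≤ 2 * β * b * (8 / T) + 2 * β * σ ^ 2 * d := by gcongr
    _ = _ := by
        rw [hσ, mul_pow, hℓ.sq_mul_nu hT hδ hδ1, ← hb]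
        ring

theorem one_le_log_log {x : ℝ} (hx : 16 ≤ x) : 1 ≤ Real.log (Real.log x) := by
  have h1 : Real.exp 1 ≤ Real.log x := by
    have h2 : Real.log 16 = 4 * Real.log 2 := by
      rw [show (16 : ℝ) = 2 ^ 4 by norm_num, Real.log_pow]; norm_num
    have h3 : Real.log 16 ≤ Real.log x := Real.log_le_log (by norm_num) hx
    linarith [Real.log_two_gt_d9, Real.exp_one_lt_d9]
  rwa [Real.le_log_iff_exp_le (lt_of_lt_of_le (Real.exp_pos 1) h1)]

/-- Inversion of `T ≥ c X (1 + log log T)`: a horizon of order `X log log (16 + X)` suffices. -/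
theorem exists_horizon {c : ℝ} (hc : 1 ≤ c) :
    ∃ C : ℝ, 0 < C ∧ ∀ X : ℝ, 0 < X → ∃ T : ℕ, 2 ≤ T ∧
      (T : ℝ) ≤ max 2 (C * X * Real.log (Real.log (16 + X))) ∧
      c * X * (1 + max (Real.log (Real.log T)) 0) ≤ T := by
  -- With `C = K ^ 2` and `K = 10 c` one has `c (3 + log C) ≤ c (3 + 2 K) ≤ C / 2`.
  set K := 10 * c with hK
  have hK10 : 10 ≤ K := by linarith
  have hKpos : 0 < K := by linarith
  have hlogC : Real.log (K ^ 2) ≤ 2 * K := by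
    rw [Real.log_pow]
    push_cast
    linarith [Real.log_le_sub_one_of_pos hKpos]
  have hlogC0 : 0 ≤ Real.log (K ^ 2) := Real.log_nonneg (by nlinarith)
  have hcK : c * (3 + Real.log (K ^ 2)) ≤ K ^ 2 / 2 := by
    have h1 : c * (3 + Real.log (K ^ 2)) ≤ c * (3 + 2 * K) := by gcongr
    have h2 : c = K / 10 := by rw [hK]; ring
    rw [h2] at h1 ⊢
    nlinarith
  refine ⟨K ^ 2, by positivity, fun X hX => ?_⟩
  set W := 16 + X with hW
  have hLL := one_le_log_log (show 16 ≤ W by linarith)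
  set y := K ^ 2 * X * Real.log (Real.log W) with hy
  have hy0 : 0 < y := by positivity
  have hT2 : y / 2 ≤ (max 2 ⌊y⌋₊ : ℕ) := by
    rcases le_or_gt y 4 with h | h
    · have : ((2 : ℕ) : ℝ) ≤ (max 2 ⌊y⌋₊ : ℕ) := by exact_mod_cast le_max_left _ _
      push_cast at this ⊢
      linarith
    · have h2 : ((⌊y⌋₊ : ℕ) : ℝ) ≤ (max 2 ⌊y⌋₊ : ℕ) := by exact_mod_cast le_max_right _ _
      have h3 := Nat.lt_floor_add_one y
      linarith
  refine ⟨max 2 ⌊y⌋₊, le_max_left _ _, ?_, ?_⟩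
  · push_cast
    exact max_le_max le_rfl (Nat.floor_le hy0.le)
  refine le_trans ?_ hT2
  have key : 1 + max (Real.log (Real.log (max 2 ⌊y⌋₊ : ℕ))) 0 ≤
      (3 + Real.log (K ^ 2)) * Real.log (Real.log W) := by
    rcases le_or_gt ⌊y⌋₊ 2 with h | h
    · rw [max_eq_left h]
      have h2 : Real.log (Real.log (2 : ℕ)) ≤ 0 := by
        have := Real.log_two_lt_d9
        have := Real.log_two_gt_d9
        refine Real.log_nonpos ?_ ?_ <;> push_cast <;> linarith
      rw [max_eq_right h2]
      nlinarith
    · rw [max_eq_right h.le]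
      have h3 : (3 : ℝ) ≤ (⌊y⌋₊ : ℕ) := by exact_mod_cast h
      have hlogW : 1 ≤ Real.log W := by
        by_contra hcon
        have h4 : 0 ≤ Real.log W := Real.log_nonneg (by linarith)
        have := Real.log_nonpos h4 (not_le.1 hcon).le
        linarith
      have hWy : (⌊y⌋₊ : ℝ) ≤ K ^ 2 * W ^ 2 := by
        have h5 : Real.log (Real.log W) ≤ W := by
          have := Real.log_le_sub_one_of_pos (by linarith : 0 < Real.log W)
          have := Real.log_le_sub_one_of_pos (by linarith : 0 < W)
          linarith
        calc (⌊y⌋₊ : ℝ) ≤ y := Nat.floor_le hy0.le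
          _ ≤ K ^ 2 * W * W := by rw [hy]; gcongr; linarith
          _ = _ := by ring
      have h6 : Real.log (⌊y⌋₊ : ℝ) ≤ (Real.log (K ^ 2) + 2) * Real.log W := by
        calc Real.log (⌊y⌋₊ : ℝ) ≤ Real.log (K ^ 2 * W ^ 2) :=
              Real.log_le_log (by linarith) hWy
          _ = Real.log (K ^ 2) + 2 * Real.log W := by
              rw [Real.log_mul (by positivity) (by positivity), Real.log_pow W]; norm_num
          _ ≤ _ := by nlinarith
      have h7 : Real.log (Real.log (⌊y⌋₊ : ℝ)) ≤
          (2 + Real.log (K ^ 2)) * Real.log (Real.log W) := by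
        calc _ ≤ Real.log ((Real.log (K ^ 2) + 2) * Real.log W) :=
              Real.log_le_log (Real.log_pos (by linarith)) h6
          _ = Real.log (Real.log (K ^ 2) + 2) + Real.log (Real.log W) :=
              Real.log_mul (by positivity) (by linarith)
          _ ≤ (Real.log (K ^ 2) + 1) + Real.log (Real.log W) := by
              linarith [Real.log_le_sub_one_of_pos (by linarith : 0 < Real.log (K ^ 2) + 2)]
          _ ≤ _ := by nlinarith
      have h8 : 0 ≤ (2 + Real.log (K ^ 2)) * Real.log (Real.log W) := by positivity
      have := max_le h7 h8
      linarith
  calc c * X * (1 + max (Real.log (Real.log (max 2 ⌊y⌋₊ : ℕ))) 0)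
      ≤ c * X * ((3 + Real.log (K ^ 2)) * Real.log (Real.log W)) := by gcongr
    _ = (c * (3 + Real.log (K ^ 2))) * (X * Real.log (Real.log W)) := by ring
    _ ≤ K ^ 2 / 2 * (X * Real.log (Real.log W)) := by gcongr
    _ = y / 2 := by rw [hy]; ring

/-- Since `log (1 / δ)` is bounded below, `h(T, δ)` is at most of order
`log (1 / δ) (1 + log log T)`. -/
theorem h_le {δ₀ δ : ℝ} (hδ₀ : δ₀ < 1) (hδ : 0 < δ) (hδδ : δ ≤ δ₀) (T : ℕ) :
    h T δ ≤ 1250 * (1 + 1 / Real.log (1 / δ₀)) * Real.log (1 / δ) *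
      (1 + max (Real.log (Real.log T)) 0) := by
  have hδ₀' : 0 < δ₀ := hδ.trans_le hδδ
  have hl0 : 0 < Real.log (1 / δ₀) := Real.log_pos (by rw [lt_div_iff₀ hδ₀']; linarith)
  have hl : Real.log (1 / δ₀) ≤ Real.log (1 / δ) :=
    Real.log_le_log (by positivity) (by gcongr)
  set m := max (Real.log (Real.log T)) 0 with hm
  have hm0 : 0 ≤ m := le_max_right _ _
  have hmT : Real.log (Real.log T) ≤ m := le_max_left _ _
  have h2 : Real.log (2 / δ) = Real.log 2 + Real.log (1 / δ) := by
    rw [← Real.log_mul (by norm_num) (by positivity)]; congr 1; ring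
  have h3 := Real.log_two_lt_d9
  set l := Real.log (1 / δ)
  set l0 := Real.log (1 / δ₀)
  have h4 : 1 ≤ 1 / l0 * l := by rw [one_div, ← div_eq_inv_mul, one_le_div hl0]; exact hl
  have hl' : 0 < l := hl0.trans_le hl
  calc h T δ = 1 + 624 * (Real.log (Real.log T) + (Real.log 2 + l)) := by rw [h, h2]
    _ ≤ 1250 * (l + 1) * (1 + m) := by nlinarith
    _ ≤ 1250 * (l + 1 / l0 * l) * (1 + m) := by gcongr
    _ = _ := by ring

theorem complexity_pos (hℓ : IsRegularLoss ℓ Θ μ β L) (h0 : 0 < rf) (h1 : rf < 1) {ε δ e : ℝ}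
    (hδ : 0 < δ) (hδ1 : δ < 1) (he : 0 < e) : 0 < complexity d μ β L rf ε δ e := by
  have := hℓ.mu_pos
  have := hℓ.beta_pos
  have := hℓ.lip_pos
  have : 0 < 1 - rf := by linarith
  have : 0 < Real.log (1 / δ) := Real.log_pos (by rw [lt_div_iff₀ hδ]; linarith)
  unfold complexity
  positivity

/-- The horizon needed for excess risk `e`, in terms of the complexity. -/
theorem IsRegularLoss.excess_bound_le (hℓ : IsRegularLoss ℓ Θ μ β L) (h0 : 0 < rf) (h1 : rf < 1)
    {δ₀ ε δ e : ℝ} (hδ₀ : δ₀ < 1) (hδ : 0 < δ) (hδδ : δ ≤ δ₀) (he : 0 < e) (hd : d ≠ 0) {T : ℕ}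
    (hT : 2 ≤ T)
    (hTX : (64 + 20000 * (1 + 1 / Real.log (1 / δ₀))) * complexity d μ β L rf ε δ e *
      (1 + max (Real.log (Real.log T)) 0) ≤ T) :
    2 * β * (gradBound μ β L rf / μ) ^ 2 * (8 + 2 * h T δ * (d * kdp ε δ ^ 2)) / T ≤ e := by
  have hμ := hℓ.mu_pos
  have hβ := hℓ.beta_pos
  have hL := hℓ.lip_pos
  have hrf : 0 < 1 - rf := by linarith
  have hT' : (0 : ℝ) < T := by exact_mod_cast (by omega : 0 < T)
  have hl : 0 < Real.log (1 / δ) := Real.log_pos (by rw [lt_div_iff₀ hδ]; linarith)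
  have hh := h_le hδ₀ hδ hδδ T
  have hl0 : 0 < Real.log (1 / δ₀) :=
    Real.log_pos (by rw [lt_div_iff₀ (hδ.trans_le hδδ)]; linarith)
  have hκ : 1 ≤ β / μ := (one_le_div hμ).2 (hℓ.mu_le_beta hd)
  set m := max (Real.log (Real.log T)) 0 with hm
  have hm0 : 0 ≤ m := le_max_right _ _
  set B : ℝ := d * kdp ε δ ^ 2 with hB
  have hB0 : 0 ≤ B := by positivity
  set l := Real.log (1 / δ)
  set q := 1 + 1 / Real.log (1 / δ₀) with hq
  have hq0 : 0 < q := by positivity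
  -- `A` is the factor of the complexity that does not involve the dimension.
  set A := (β / μ) ^ 3 * (L ^ 2 / μ / e) * (rf / (1 - rf)) ^ 2 with hA
  have hA0 : 0 < A := by positivity
  have hX : complexity d μ β L rf ε δ e = A * (1 + B * l) := by
    rw [complexity, hA, hB]; ring
  rw [hX] at hTX
  have h2 : β * (gradBound μ β L rf / μ) ^ 2 ≤ 4 * (A * e) := by
    have h3 : β * (gradBound μ β L rf / μ) ^ 2 =
        β / μ * (L ^ 2 / μ) * (rf / (1 - rf)) ^ 2 * (1 + β / μ) ^ 2 := by
      unfold gradBound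
      generalize 1 + β / μ = κ
      generalize rf / (1 - rf) = ρ
      field_simp
    have h4 : 4 * (A * e) =
        β / μ * (L ^ 2 / μ) * (rf / (1 - rf)) ^ 2 * (2 * (β / μ)) ^ 2 := by
      rw [hA]
      generalize β / μ = κ
      generalize rf / (1 - rf) = ρ
      field_simp
      ring
    rw [h3, h4]
    gcongr
    linarith
  have h5 : 8 + 2 * h T δ * B ≤ (8 + 2500 * q) * (1 + B * l) * (1 + m) := by
    calc 8 + 2 * h T δ * B ≤ 8 + 2 * (1250 * q * l * (1 + m)) * B := by gcongr
      _ ≤ _ := by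
        have e1 : (8 + 2500 * q) * (1 + B * l) * (1 + m) =
            8 + 2 * (1250 * q * l * (1 + m)) * B +
            (8 * m + (8 * (B * l) + 2500 * q) * (1 + m)) := by ring
        rw [e1]
        have : 0 ≤ 8 * m + (8 * (B * l) + 2500 * q) * (1 + m) := by positivity
        linarith
  rw [div_le_iff₀ hT']
  calc 2 * β * (gradBound μ β L rf / μ) ^ 2 * (8 + 2 * h T δ * B)
      ≤ 2 * β * (gradBound μ β L rf / μ) ^ 2 * ((8 + 2500 * q) * (1 + B * l) * (1 + m)) := by
        gcongr
    _ = 2 * (β * (gradBound μ β L rf / μ) ^ 2) * ((8 + 2500 * q) * (1 + B * l) * (1 + m)) := by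
        ring
    _ ≤ 2 * (4 * (A * e)) * ((8 + 2500 * q) * (1 + B * l) * (1 + m)) := by gcongr
    _ = e * ((64 + 20000 * q) * (A * (1 + B * l)) * (1 + m)) := by ring
    _ ≤ e * T := by gcongr

theorem exists_convergenceTime_eq {U : ℕ → Measure (E d)} {e : ℝ} {T : ℕ} (hT : 2 ≤ T)
    (hi : Integrable (fun θ => risk ℓ Dr θ - risk ℓ Dr (argMin (risk ℓ Dr))) (U T))
    (he : ∫ θ, (risk ℓ Dr θ - risk ℓ Dr (argMin (risk ℓ Dr))) ∂(U T) ≤ e) :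
    ∃ n : ℕ, convergenceTime ℓ Dr U e = n ∧ n ≤ T := by
  have hle : convergenceTime ℓ Dr U e ≤ T := iInf₂_le T ⟨hT, hi, he⟩
  obtain ⟨n, hn⟩ := ENat.ne_top_iff_exists.1 (ne_top_of_le_ne_top (ENat.natCast_ne_top T) hle)
  refine ⟨n, hn.symm, ?_⟩
  rw [← hn] at hle
  exact_mod_cast hle

end VRU

theorem theorem1 :
    (∀ (d s : ℕ) (ℓ : VRU.E d → VRU.E s → ℝ) (Θ : Set (VRU.E d)) (μ β L rf ε δ : ℝ) (T : ℕ),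
      VRU.IsRegularLoss ℓ Θ μ β L → 0 < rf → rf < 1 → 0 < ε → ε ≤ 1 → 0 < δ → δ < 1 → 2 ≤ T →
      VRU.IsUnlearning (VRU.Admissible ℓ Θ rf) (VRU.vru ℓ μ β L rf ε δ T) ε δ) ∧
    (∀ δ₀ : ℝ, 0 < δ₀ → δ₀ < 1 → ∃ C : ℝ, 0 < C ∧
      ∀ (d s : ℕ) (ℓ : VRU.E d → VRU.E s → ℝ) (Θ : Set (VRU.E d)) (μ β L rf ε δ e : ℝ)
        (Dr Df : MeasureTheory.Measure (VRU.E s)),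
        VRU.IsRegularLoss ℓ Θ μ β L → 0 < rf → rf < 1 → 0 < ε → 0 < δ → δ ≤ δ₀ → 0 < e →
        VRU.Admissible ℓ Θ rf Dr Df →
        ∃ T : ℕ,
          VRU.convergenceTime ℓ Dr (fun n => VRU.vru ℓ μ β L rf ε δ n Dr Df) e = T ∧
          (T : ℝ) ≤ max 2 (C * VRU.complexity d μ β L rf ε δ e *
            Real.log (Real.log (16 + VRU.complexity d μ β L rf ε δ e)))) := by
  refine ⟨fun d s ℓ Θ μ β L rf ε δ T hℓ h0 h1 hε hε1 hδ hδ1 hT =>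
    VRU.isUnlearning_vru hℓ h0 h1 hε hε1 hδ hδ1 hT, fun δ₀ hδ₀ hδ₀1 => ?_⟩
  have hl0 : 0 < Real.log (1 / δ₀) := Real.log_pos (by rw [lt_div_iff₀ hδ₀]; linarith)
  obtain ⟨C, hC, hCX⟩ := VRU.exists_horizon
    (c := 64 + 20000 * (1 + 1 / Real.log (1 / δ₀))) (by
      have : 0 < 1 / Real.log (1 / δ₀) := by positivity
      linarith)
  refine ⟨C, hC, fun d s ℓ Θ μ β L rf ε δ e Dr Df hℓ h0 h1 hε hδ hδδ he hD => ?_⟩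
  have hδ1 : δ < 1 := hδδ.trans_lt hδ₀1
  rcases eq_or_ne d 0 with rfl | hd
  · -- In dimension zero the excess risk vanishes, but `μ ≤ β` may fail.
    obtain ⟨hi, -⟩ := hD.integral_excess_le hℓ h0 h1 (ε := ε) hδ hδ1 le_rfl
    have hz : ∀ θ, VRU.risk ℓ Dr θ - VRU.risk ℓ Dr (VRU.argMin (VRU.risk ℓ Dr)) = 0 := fun θ => by
      rw [Subsingleton.elim θ (VRU.argMin (VRU.risk ℓ Dr)), sub_self]
    obtain ⟨n, hn, hn2⟩ := VRU.exists_convergenceTime_eq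
      (U := fun n => VRU.vru ℓ μ β L rf ε δ n Dr Df) (e := e) le_rfl hi (by simp [hz, he.le])
    exact ⟨n, hn, le_max_of_le_left (by exact_mod_cast hn2)⟩
  · obtain ⟨T, hT, hTle, hTX⟩ := hCX _ (VRU.complexity_pos (ε := ε) hℓ h0 h1 hδ hδ1 he)
    obtain ⟨hi, hle⟩ := hD.integral_excess_le hℓ h0 h1 (ε := ε) hδ hδ1 hT
    obtain ⟨n, hn, hnT⟩ := VRU.exists_convergenceTime_eq
      (U := fun n => VRU.vru ℓ μ β L rf ε δ n Dr Df) hT hi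
      (hle.trans (hℓ.excess_bound_le h0 h1 hδ₀1 hδ hδδ he hd hT hTX))
    exact ⟨n, hn, le_trans (by exact_mod_cast hnT) hTle⟩
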